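/- \textbf{Proposition (Exact adjoint relation).} Let $d\ge 1$ and let $\Omega\subset\mathbb{R}^d$ be a bounded open set with Lipschitz boundary, with outward unit normal $\hat{n}$ (which exists almost everywhere on $\partial\Omega$ with respect to the surface measure $dS$). Write $(f,g)=\int_\Omega f\cdot g\,dx$ for vector fields $f,g:\Omega\to\mathbb{R}^d$. Let $a\in C^1(\overline\Omega;\mathbb{R}^d)$, that is, $a$ is differentiable in $\Omega$ and $a$ and its derivative are continuous up to the boundary. For $s\in\mathbb{R}$ define the generalized linear advection operator \[ A_s^a u := (a\cdot\nabla)u + s(\nabla\cdot a)u , \] in particular the convective form $A_0^a u=(a\cdot\nabla)u$, the skew-symmetric form $A_{1/2}^a u=(a\cdot\nabla)u+\tfrac12(\nabla\cdot a)u$ and the divergence form $A_1^a u=\nabla\cdot(u a^T)$, with components $\sum_j\partial_j(u_i a_j)$. (i) For all $u,v\in C^1(\overline\Omega;\mathbb{R}^d)$ and all $s\in\mathbb{R}$, all the integrals below converge absolutely and \[ (v, A_s^a u) = (-A_{1-s}^a v, u) + \int_{\partial\Omega} v\cdot\bigl(\hat n\cdot(u a^T)\bigr)\,dS , \] where $\hat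 n\cdot(u a^T)$ is the vector with components $\sum_j \hat n_j u_i a_j$, that is, $(a\cdot\hat n)u$. (ii) In particular, the adjoint of $A_s^a$ is $(A_s^a)^*=-A_{1-s}^a$ for every $s\in\mathbb{R}$, in the following sense: for every $C^1$ vector field $v$ with compact support in $\Omega$, one has $(v,A_s^a u)=(-A_{1-s}^a v,u)$ for all $u\in C^1(\Omega;\mathbb{R}^d)$ (both integrals converging absolutely), and every locally integrable vector field $w$ on $\Omega$ such that $(v,A_s^a u)=(w,u)$ for all $u\in C_c^\infty(\Omega;\mathbb{R}^d)$ equals $-A_{1-s}^a v$ almost everywhere in $\Omega$. Thus, in the same sense, the convective and the divergence forms are adjoint to each other up to sign, $((a\cdot\nabla)\,\cdot\,)^*=-\nabla\cdot(\,\cdot\;a^T)$ and $(\nabla\cdot(\,\cdot\;a^T))^*=-(a\cdot\nabla)\,\cdot\,$, and the skew-symmetric form is skew-adjoint, $(A_{1/2}^a)^*=-A_{1/2}^a$. -/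

import Mathlib

open MeasureTheory Set Topology
open scoped ContDiff

noncomputable section

/-- `d`-dimensional Euclidean space `ℝᵈ`. -/
abbrev Space (d : ℕ) : Type := EuclideanSpace ℝ (Fin d)

namespace Advection

variable {d : ℕ}

/-! ### Domains, surface measure and outward normal -/

/-- `Ω` has Lipschitz boundary: near each of its boundary points, `Ω` is the region lying strictly
below the graph of a Lipschitz function, with respect to a suitable unit vector `e` as vertical
direction. Here `⟪x, e⟫` is the height of `x`, and `x - ⟪x, e⟫ e` its horizontal component. -/
def HasLipschitzBoundary (Ω : Set (Space d)) : Prop :=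
  ∀ p ∈ frontier Ω, ∃ (e : Space d) (K : NNReal) (γ : Space d → ℝ) (U : Set (Space d)),
    ‖e‖ = 1 ∧ LipschitzWith K γ ∧ IsOpen U ∧ p ∈ U ∧
      ∀ x ∈ U, x ∈ Ω ↔ inner ℝ x e < γ (x - inner ℝ x e • e)

/-- The surface measure of `∂Ω`: the `(d-1)`-dimensional Hausdorff measure, normalised so that it is
Lebesgue measure on hyperplanes, restricted to the boundary of `Ω`. -/
def surfaceMeasure (Ω : Set (Space d)) : Measure (Space d) :=
  (Measure.euclideanHausdorffMeasure (d - 1)).restrict (frontier Ω)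

/-- `n` is an outward unit normal of `Ω` at `x`: near `x`, the points that make an angle with the
tangent hyperplane `n^⊥` bounded away from `0` belong to `Ω` on the side of `-n`, and do not belong
to `Ω` on the side of `n`. -/
def IsOutwardUnitNormal (Ω : Set (Space d)) (x n : Space d) : Prop :=
  ‖n‖ = 1 ∧ ∀ ε > 0, ∀ᶠ y in 𝓝 x,
    (inner ℝ (y - x) n < -(ε * ‖y - x‖) → y ∈ Ω) ∧ (ε * ‖y - x‖ < inner ℝ (y - x) n → y ∉ Ω)

/-- A set has at most one outward unit normal at a given point. -/
theorem IsOutwardUnitNormal.unique {Ω : Set (Space d)} {x n n' : Space d}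
    (h : IsOutwardUnitNormal Ω x n) (h' : IsOutwardUnitNormal Ω x n') : n = n' := by
  by_contra hne
  have hm : 0 < ‖n - n'‖ := norm_pos_iff.mpr (sub_ne_zero.mpr hne)
  have hsq : ‖n - n'‖ ^ 2 = 2 - 2 * inner ℝ n n' := by
    rw [norm_sub_sq_real, h.1, h'.1]; ring
  have hev := (h.2 (‖n - n'‖ / 4) (by positivity)).and (h'.2 (‖n - n'‖ / 4) (by positivity))
  have hc : Filter.Tendsto (fun t : ℝ => x + t • (n - n')) (𝓝[>] 0) (𝓝 x) := by
    have : ContinuousAt (fun t : ℝ => x + t • (n - n')) 0 := by fun_prop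
    have h2 := this.tendsto
    simp only [zero_smul, add_zero] at h2
    exact h2.mono_left nhdsWithin_le_nhds
  obtain ⟨t, ht, ht0⟩ := ((hc.eventually hev).and self_mem_nhdsWithin).exists
  have ht0 : 0 < t := ht0
  have e1 : x + t • (n - n') - x = t • (n - n') := by abel
  have e2 : inner ℝ (t • (n - n')) n = t * (‖n - n'‖ ^ 2 / 2) := by
    rw [real_inner_smul_left, inner_sub_left, real_inner_self_eq_norm_sq, h.1, hsq,
      real_inner_comm]; ring
  have e3 : inner ℝ (t • (n - n')) n' = -(t * (‖n - n'‖ ^ 2 / 2)) := by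
    rw [real_inner_smul_left, inner_sub_left, real_inner_self_eq_norm_sq, h'.1, hsq]; ring
  have e4 : ‖t • (n - n')‖ = t * ‖n - n'‖ := by rw [norm_smul, Real.norm_of_nonneg ht0.le]
  have key : ‖n - n'‖ / 4 * (t * ‖n - n'‖) < t * (‖n - n'‖ ^ 2 / 2) := by
    have : 0 < t * ‖n - n'‖ ^ 2 := by positivity
    nlinarith
  rw [e1, e2, e3, e4] at ht
  exact ht.1.2 key (ht.2.1 (by linarith))

open Classical in
/-- The outward unit normal field `n̂` of `Ω` (`0` at the points where there is none). -/
def outwardNormal (Ω : Set (Space d)) (x : Space d) : Space d :=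
  if h : ∃ n, IsOutwardUnitNormal Ω x n then h.choose else 0

/-! ### Regularity classes -/

/-- `u ∈ C¹(Ω̄; ℝᵈ)` for an open set `Ω`: `u` is differentiable in `Ω`, and both `u` and its
derivative are continuous up to the boundary of `Ω`. -/
def IsC1UpToBoundary (Ω : Set (Space d)) (u : Space d → Space d) : Prop :=
  ContinuousOn u (closure Ω) ∧ ∃ D : Space d → Space d →L[ℝ] Space d,
    ContinuousOn D (closure Ω) ∧ ∀ x ∈ Ω, HasFDerivAt u (D x) x

/-- `u` is a vector field of class `Cᵏ` with compact support contained in `Ω`. -/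
def IsCompactlySupportedIn (k : WithTop ℕ∞) (Ω : Set (Space d)) (u : Space d → Space d) : Prop :=
  ContDiff ℝ k u ∧ HasCompactSupport u ∧ tsupport u ⊆ Ω

/-! ### Differential operators -/

/-- The partial derivative `∂ⱼ f`. -/
def partialDeriv {F : Type*} [NormedAddCommGroup F] [NormedSpace ℝ F]
    (j : Fin d) (f : Space d → F) (x : Space d) : F :=
  fderiv ℝ f x (EuclideanSpace.single j 1)

/-- The divergence `∇·a = ∑ⱼ ∂ⱼ aⱼ` of a vector field. -/
def divergence (a : Space d → Space d) (x : Space d) : ℝ :=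
  ∑ j, partialDeriv j (fun y => a y j) x

/-- The tensor field `u aᵀ`, with entries `uᵢ aⱼ`. -/
def outer (u a : Space d → Space d) (x : Space d) : Matrix (Fin d) (Fin d) ℝ :=
  Matrix.of fun i j => u x i * a x j

/-- The divergence `∇·M` of a tensor field, with components `∑ⱼ ∂ⱼ Mᵢⱼ`. -/
def tensorDivergence (M : Space d → Matrix (Fin d) (Fin d) ℝ) (x : Space d) : Space d :=
  WithLp.toLp 2 fun i => ∑ j, partialDeriv j (fun y => M y i j) x

/-- The contraction `n·M` of a tensor with a normal vector, with components `∑ⱼ nⱼ Mᵢⱼ`;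
it is the flux that belongs to the divergence `∑ⱼ ∂ⱼ Mᵢⱼ`. -/
def normalContraction (n : Space d) (M : Matrix (Fin d) (Fin d) ℝ) : Space d :=
  WithLp.toLp 2 fun i => ∑ j, n j * M i j

/-- The convective form `(a·∇)u = ∑ⱼ aⱼ ∂ⱼ u`. -/
def convectiveForm (a u : Space d → Space d) (x : Space d) : Space d :=
  ∑ j, a x j • partialDeriv j u x

/-- The divergence form `∇·(u aᵀ)`. -/
def divergenceForm (a u : Space d → Space d) : Space d → Space d :=
  tensorDivergence (outer u a)

/-- The generalized linear advection operator `A_s^a u = (a·∇)u + s(∇·a)u`. -/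
def advection (s : ℝ) (a u : Space d → Space d) (x : Space d) : Space d :=
  convectiveForm a u x + (s * divergence a x) • u x

/-- The skew-symmetric form `(a·∇)u + ½(∇·a)u`. -/
def skewForm (a u : Space d → Space d) : Space d → Space d :=
  advection (1 / 2) a u

/-! ### Inner products and adjoints -/

/-- The inner product `(f, g) = ∫_Ω f·g dx`. -/
def innerOn (Ω : Set (Space d)) (f g : Space d → Space d) : ℝ :=
  ∫ x in Ω, inner ℝ (f x) (g x)

/-- The pairing `(f, g)` is well defined: `f·g` is integrable over `Ω`. -/
def PairingIntegrable (Ω : Set (Space d)) (f g : Space d → Space d) : Prop :=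
  IntegrableOn (fun x => inner ℝ (f x) (g x)) Ω

/-- `B` is the (formal) adjoint of the differential operator `A` on `Ω`: for each compactly
supported `C¹` field `v` in `Ω` the identity `(v, A u) = (B v, u)` holds for all `u ∈ C¹(Ω)`,
and `B v` is determined by it, almost everywhere in `Ω`, among all locally integrable fields, even
if the identity is only tested with smooth compactly supported `u`. -/
def IsFormalAdjoint (Ω : Set (Space d))
    (A B : (Space d → Space d) → Space d → Space d) : Prop :=
  ∀ v, IsCompactlySupportedIn 1 Ω v →
    (∀ u, ContDiffOn ℝ 1 u Ω →
      PairingIntegrable Ω v (A u) ∧ PairingIntegrable Ω (B v) u ∧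
        innerOn Ω v (A u) = innerOn Ω (B v) u) ∧
    (∀ w, LocallyIntegrableOn w Ω →
      (∀ u, IsCompactlySupportedIn ∞ Ω u → innerOn Ω v (A u) = innerOn Ω w u) →
        w =ᵐ[volume.restrict Ω] B v)

/-- The boundary integrand `v·(n̂·(u aᵀ))`. -/
def boundaryFlux (Ω : Set (Space d)) (a u v : Space d → Space d) (x : Space d) : ℝ :=
  inner ℝ (v x) (normalContraction (outwardNormal Ω x) (outer u a x))

end Advection

end

/-! The adjoint relation is the divergence theorem for the field `(v·u) a`. The product rule gives
`v·A_s u + (A_{1-s} v)·u = ∇·((v·u) a)` pointwise (`inner_advection_sub`): the convective terms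
combine to `a·∇(v·u)`, and the weights `s` and `1 - s` add up to one full `∇·a`. Integrating over
`Ω` gives (i). If `v` has compact support in `Ω`, the integral of the divergence vanishes, which
gives the identity in (ii); uniqueness is the fundamental lemma of the calculus of variations
(`ae_eq_of_innerOn_eq`).

The main work is the divergence theorem on a Lipschitz domain (`integral_divergence_eq_boundary`). A
partition of unity reduces it to a field `G` supported where `Ω` is the set of positive depth below
a Lipschitz graph. Let the cutoff `χ_ε` rise linearly from 0 to 1 between the depths `ε` and `2ε`.
Integration by parts gives `∫ χ_ε ∇·G = -∫ ∇χ_ε·G`. In volume-preserving graph coordinates with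
depth `εσ`, the right side is an average over `σ ∈ (1, 2)`, in which the derivative of the depth
depends only on the horizontal variable. As `ε → 0`, only the continuity of `G` up to the boundary
is needed, and no continuity of the gradient of `γ`.

The limit becomes a surface integral because, by Rademacher's theorem, the negative gradient of the
depth exists almost everywhere and is the outward normal times `√(1 + |∇γ|²)`. This length is also
the density of the Hausdorff measure on the graph, by the area formula
(`euclideanHausdorffMeasure_image_eq_lintegral_normDet`), which is proved by cutting the domain into
pieces on which the map is nearly linear. -/

noncomputable section

/-! ### The area formula -/

/-- If `f` expands distances on `S` at most `c` times as much as `g` does, then the `k`-dimensional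
measure of `f '' S` is at most `c ^ k` times that of `g '' S`. -/
theorem MeasureTheory.Measure.euclideanHausdorffMeasure_image_le_of_dist_le {X Y Z : Type*}
    [MetricSpace Y] [MeasurableSpace Y] [BorelSpace Y]
    [MetricSpace Z] [MeasurableSpace Z] [BorelSpace Z] {f : X → Y} {g : X → Z} {S : Set X}
    {c : NNReal} (h : ∀ x ∈ S, ∀ y ∈ S, dist (f x) (f y) ≤ c * dist (g x) (g y)) (k : ℕ) :
    Measure.euclideanHausdorffMeasure k (f '' S) ≤
      (c : ENNReal) ^ k * Measure.euclideanHausdorffMeasure k (g '' S) := by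
  rcases S.eq_empty_or_nonempty with rfl | ⟨x₀, hx₀⟩
  · simp
  have : Nonempty X := ⟨x₀⟩
  -- `g` need not be injective, but points of `S` with equal `g`-value have equal `f`-value. Hence
  -- `f` factors through `g` by a map `φ` that is `c`-Lipschitz on `g '' S`.
  set φ : Z → Y := fun z => f (Function.invFunOn g S z) with hφ
  have hmem : ∀ x ∈ S, Function.invFunOn g S (g x) ∈ S := fun x hx =>
    Function.invFunOn_mem ⟨x, hx, rfl⟩
  have heq : ∀ x ∈ S, g (Function.invFunOn g S (g x)) = g x := fun x hx =>
    Function.invFunOn_eq ⟨x, hx, rfl⟩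
  have himg : f '' S = φ '' (g '' S) := by
    rw [image_image]
    refine image_congr fun x hx => ?_
    have := h x hx _ (hmem x hx)
    rw [heq x hx, dist_self, mul_zero] at this
    exact dist_le_zero.mp this
  have hlip : LipschitzOnWith c φ (g '' S) := by
    refine LipschitzOnWith.of_dist_le_mul ?_
    rintro _ ⟨x, hx, rfl⟩ _ ⟨y, hy, rfl⟩
    have := h _ (hmem x hx) _ (hmem y hy)
    rwa [heq x hx, heq y hy] at this
  rw [himg]
  simp only [Measure.euclideanHausdorffMeasure_def, Measure.smul_apply, ENNReal.smul_def,
    smul_eq_mul]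
  have := hlip.hausdorffMeasure_image_le (d := (k : ℝ)) (by positivity)
  rw [ENNReal.rpow_natCast] at this
  rw [mul_left_comm]
  gcongr

/-- The norm determinant of the graph map of a linear functional. -/
theorem LinearMap.normDet_graph {U V : Type*} [NormedAddCommGroup U]
    [InnerProductSpace ℝ U] [FiniteDimensional ℝ U] [NormedAddCommGroup V] [InnerProductSpace ℝ V]
    {f : U →ₗ[ℝ] V} {L : U →ₗᵢ[ℝ] V} {p : U} {e : V} (he : ‖e‖ = 1)
    (hLe : ∀ v, inner ℝ (L v) e = 0) (hf : ∀ v, f v = L v + inner ℝ p v • e) :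
    f.normDet = √(1 + ‖p‖ ^ 2) := by
  have h := f.normDet_sq_eq_det_gram (stdOrthonormalBasis ℝ U)
  set b := stdOrthonormalBasis ℝ U
  -- The Gram matrix is a rank-one perturbation of the identity, so the matrix determinant lemma
  -- yields `1 + ‖p‖ ^ 2`.
  have hgram : Matrix.gram ℝ (fun i => f (b i)) =
      1 + Matrix.replicateCol Unit (fun i => inner ℝ p (b i)) *
        Matrix.replicateRow Unit (fun i => inner ℝ p (b i)) := by
    ext i j
    have hLe' : ∀ v, inner ℝ e (L v) = 0 := fun v => by rw [real_inner_comm, hLe]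
    simp [Matrix.gram, hf, inner_add_left, inner_add_right, hLe, hLe', inner_smul_left,
      inner_smul_right, he, Matrix.mul_apply, Matrix.one_apply,
      orthonormal_iff_ite.mp b.orthonormal i j, mul_comm]
  rw [hgram, Matrix.det_one_add_replicateCol_mul_replicateRow] at h
  have hsum : (fun i => inner ℝ p (b i)) ⬝ᵥ (fun i => inner ℝ p (b i)) = ‖p‖ ^ 2 := by
    rw [← b.sum_sq_norm_inner_left p]
    simp [dotProduct, sq]
  rw [hsum] at h
  rw [← Real.sqrt_sq f.normDet_nonneg]
  congr 1
section AreaFormula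

variable {U V : Type*} [NormedAddCommGroup U] [InnerProductSpace ℝ U] [FiniteDimensional ℝ U]
  [MeasurableSpace U] [BorelSpace U] [NormedAddCommGroup V] [InnerProductSpace ℝ V]
  [FiniteDimensional ℝ V] [MeasurableSpace V] [BorelSpace V]

open Module

/-- A linear map that is bounded by `c` times another one has norm determinant at most
`c ^ dim` times that of the other one. -/
theorem LinearMap.normDet_le_of_norm_le {A B : U →ₗ[ℝ] V} {c : NNReal}
    (h : ∀ v, ‖A v‖ ≤ c * ‖B v‖) :
    ENNReal.ofReal A.normDet ≤ (c : ENNReal) ^ finrank ℝ U * ENNReal.ofReal B.normDet := by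
  -- The norm determinant is the factor by which the map scales the measure of the unit ball, so
  -- comparing the two images of the ball suffices.
  have key := Measure.euclideanHausdorffMeasure_image_le_of_dist_le
    (f := A) (g := B) (S := Metric.ball (0 : U) 1) (c := c)
    (fun x _ y _ => by simpa [dist_eq_norm, ← map_sub] using h (x - y)) (finrank ℝ U)
  rw [LinearMap.euclideanHausdorffMeasure_image_eq_normDet_mul_volume,
    LinearMap.euclideanHausdorffMeasure_image_eq_normDet_mul_volume, ← mul_assoc] at key
  have h0 : (volume (Metric.ball (0 : U) 1)) ≠ 0 := (Metric.measure_ball_pos _ _ one_pos).ne'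
  have h1 : (volume (Metric.ball (0 : U) 1)) ≠ ⊤ := measure_ball_lt_top.ne
  exact (ENNReal.mul_le_mul_iff_left h0 h1).mp key

/-- Two-sided comparison of area and Jacobian integral on a set where the map is uniformly
approximated by one expanding linear map. -/
theorem ApproximatesLinearOn.area_bounds {f : U → V} {A : U →L[ℝ] V} {S : Set U} {r c : NNReal}
    (hf : ApproximatesLinearOn f A S r) (hA : ∀ v, ‖v‖ ≤ ‖A v‖) (hS : MeasurableSet S)
    (hr : (c : ℝ) * (1 - r) = 1) (hrc : (1 : ℝ) + r ≤ c)
    (hclose : ∀ x ∈ S, ‖fderiv ℝ f x - A‖ ≤ r) :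
    Measure.euclideanHausdorffMeasure (finrank ℝ U) (f '' S) ≤
      (c : ENNReal) ^ (2 * finrank ℝ U) *
        ∫⁻ x in S, ENNReal.ofReal (fderiv ℝ f x).toLinearMap.normDet ∧
    ∫⁻ x in S, ENNReal.ofReal (fderiv ℝ f x).toLinearMap.normDet ≤
      (c : ENNReal) ^ (2 * finrank ℝ U) *
        Measure.euclideanHausdorffMeasure (finrank ℝ U) (f '' S) := by
  have hc0 : (0 : ℝ) < c := by have := r.2; have := c.2; by_contra hh; nlinarith
  set k := finrank ℝ U
  -- Since `c = 1 / (1 - r)` and `1 + r ≤ c`, a relative error `r` in either direction costs at most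
  -- a factor `c`.
  have aux1 : ∀ v w : ℝ, 0 ≤ v → v ≤ (1 + r) * w → 0 ≤ w → v ≤ c * w := fun v w _ h hw =>
    h.trans (by gcongr)
  have aux2 : ∀ v w : ℝ, (1 - r) * v ≤ w → v ≤ c * w := fun v w h => by
    have := mul_le_mul_of_nonneg_left h hc0.le
    rwa [← mul_assoc, hr, one_mul] at this
  -- Because `A` expands, an error relative to `‖x - y‖` is also an error relative to `‖A (x - y)‖`.
  have hd : ∀ x ∈ S, ∀ y ∈ S, ‖f x - f y - A (x - y)‖ ≤ r * ‖A (x - y)‖ := fun x hx y hy =>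
    (hf x hx y hy).trans (by gcongr; exact hA _)
  have e1 := Measure.euclideanHausdorffMeasure_image_le_of_dist_le (f := f) (g := A) (S := S)
    (c := c) (fun x hx y hy => by
      rw [dist_eq_norm, dist_eq_norm, ← map_sub]
      refine aux1 _ _ (norm_nonneg _) ?_ (norm_nonneg _)
      have := norm_add_le (f x - f y - A (x - y)) (A (x - y))
      rw [sub_add_cancel] at this
      linarith [hd x hx y hy]) k
  have e2 := Measure.euclideanHausdorffMeasure_image_le_of_dist_le (f := A) (g := f) (S := S)
    (c := c) (fun x hx y hy => by
      rw [dist_eq_norm, dist_eq_norm, ← map_sub]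
      refine aux2 _ _ ?_
      have := norm_sub_le (f x - f y) (f x - f y - A (x - y))
      rw [sub_sub_cancel] at this
      linarith [hd x hx y hy]) k
  have hvol : Measure.euclideanHausdorffMeasure k (A '' S) =
      ENNReal.ofReal A.toLinearMap.normDet * volume S :=
    LinearMap.euclideanHausdorffMeasure_image_eq_normDet_mul_volume A.toLinearMap S
  have hd' : ∀ x ∈ S, ∀ v, ‖fderiv ℝ f x v - A v‖ ≤ r * ‖A v‖ := fun x hx v =>
    ((fderiv ℝ f x - A).le_of_opNorm_le (hclose x hx) v).trans (by gcongr; exact hA _)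
  have e3 : ∀ x ∈ S, ENNReal.ofReal (fderiv ℝ f x).toLinearMap.normDet ≤
      (c : ENNReal) ^ k * ENNReal.ofReal A.toLinearMap.normDet := fun x hx =>
    LinearMap.normDet_le_of_norm_le fun v => by
      refine aux1 _ _ (norm_nonneg _) ?_ (norm_nonneg _)
      have := norm_add_le (fderiv ℝ f x v - A v) (A v)
      rw [sub_add_cancel] at this
      simp only [ContinuousLinearMap.coe_coe]
      linarith [hd' x hx v]
  have e4 : ∀ x ∈ S, ENNReal.ofReal A.toLinearMap.normDet ≤
      (c : ENNReal) ^ k * ENNReal.ofReal (fderiv ℝ f x).toLinearMap.normDet := fun x hx =>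
    LinearMap.normDet_le_of_norm_le fun v => by
      refine aux2 _ _ ?_
      have := norm_sub_le (fderiv ℝ f x v) (fderiv ℝ f x v - A v)
      rw [sub_sub_cancel] at this
      simp only [ContinuousLinearMap.coe_coe]
      linarith [hd' x hx v]
  have hcne : (c : ENNReal) ^ k ≠ ⊤ := by finiteness
  constructor
  -- Replacing `f` by `A` costs `c ^ k`, and replacing `A` by the derivative of `f` costs another `c
  -- ^ k`; hence the exponent `2 * k`.
  · calc _ ≤ (c : ENNReal) ^ k * (ENNReal.ofReal A.toLinearMap.normDet * volume S) := by
          rw [← hvol]; exact e1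
      _ = (c : ENNReal) ^ k * ∫⁻ _ in S, ENNReal.ofReal A.toLinearMap.normDet := by
          rw [setLIntegral_const]
      _ ≤ (c : ENNReal) ^ k * ∫⁻ x in S, (c : ENNReal) ^ k *
            ENNReal.ofReal (fderiv ℝ f x).toLinearMap.normDet := by
          exact mul_le_mul_right (setLIntegral_mono' hS e4) _
      _ = _ := by rw [lintegral_const_mul' _ _ hcne, ← mul_assoc, ← pow_add, two_mul]
  · calc _ ≤ ∫⁻ _ in S, (c : ENNReal) ^ k * ENNReal.ofReal A.toLinearMap.normDet :=
          setLIntegral_mono' hS e3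
      _ = (c : ENNReal) ^ k * (ENNReal.ofReal A.toLinearMap.normDet * volume S) := by
          rw [setLIntegral_const, mul_assoc]
      _ ≤ (c : ENNReal) ^ k * ((c : ENNReal) ^ k *
            Measure.euclideanHausdorffMeasure k (f '' S)) := by
          rw [← hvol]; gcongr
      _ = _ := by rw [← mul_assoc, ← pow_add, two_mul]

/-- A measurable set on which `f` is differentiable splits into countably many measurable pieces on
each of which `f` and its derivative are uniformly close to one of the derivatives of `f`. -/
theorem exists_partition_approximatesLinearOn_fderiv {f : U → V} {S : Set U}
    (hS : MeasurableSet S) (hd : ∀ x ∈ S, DifferentiableAt ℝ f x) {r : NNReal} (hr : r ≠ 0) :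
    ∃ (t : ℕ → Set U) (A : ℕ → U →L[ℝ] V), Pairwise (Function.onFun Disjoint t) ∧
      (∀ n, MeasurableSet (t n)) ∧ ⋃ n, t n = S ∧
      ∀ n, ApproximatesLinearOn f (A n) (t n) r ∧ ∀ x ∈ t n, ‖fderiv ℝ f x - A n‖ ≤ r ∧
        ∃ y ∈ S, A n = fderiv ℝ f y := by
  have : BorelSpace (U →L[ℝ] V) := ⟨rfl⟩
  have hr2 : (0 : ℝ) < r / 2 := half_pos (NNReal.coe_pos.mpr (pos_iff_ne_zero.mpr hr))
  obtain ⟨Q, hQc, hQd⟩ := TopologicalSpace.exists_countable_dense (U →L[ℝ] V)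
  obtain ⟨B, hB⟩ : ∃ B : ℕ → U →L[ℝ] V, Dense (range B) := by
    obtain ⟨B, hB⟩ := hQc.exists_eq_range hQd.nonempty
    exact ⟨B, hB ▸ hQd⟩
  -- On `P m` all derivatives lie within `r / 2` of `B m`, hence within `r` of each other. Refining
  -- `P m` into pieces of linear approximation keeps this, since each approximating map is a
  -- derivative of `f` at some point of `P m`.
  set P : ℕ → Set U := disjointed fun m => S ∩ fderiv ℝ f ⁻¹' Metric.ball (B m) (r / 2) with hP
  have hPm : ∀ m, MeasurableSet (P m) := fun m => MeasurableSet.disjointed (fun i =>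
    hS.inter (measurable_fderiv ℝ f Metric.isOpen_ball.measurableSet)) m
  have hPsub : ∀ m, P m ⊆ S ∩ fderiv ℝ f ⁻¹' Metric.ball (B m) (r / 2) := fun m =>
    disjointed_subset _ m
  have hPU : ⋃ m, P m = S := by
    rw [hP, iUnion_disjointed]
    refine Subset.antisymm (iUnion_subset fun m => inter_subset_left) fun x hx => ?_
    obtain ⟨_, ⟨m, rfl⟩, hb⟩ := hB.exists_dist_lt (fderiv ℝ f x) hr2
    exact mem_iUnion.mpr ⟨m, hx, by simpa using hb⟩
  choose t A ht1 ht2 ht3 ht4 ht5 using fun m =>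
    exists_partition_approximatesLinearOn_of_hasFDerivWithinAt f (P m) (fderiv ℝ f)
      (fun x hx => (hd x (hPsub m hx).1).hasFDerivAt.hasFDerivWithinAt) (fun _ => r)
      (fun _ => hr)
  let e : ℕ ≃ ℕ × ℕ := Nat.pairEquiv.symm
  refine ⟨fun n => P (e n).1 ∩ t (e n).1 (e n).2, fun n => A (e n).1 (e n).2, ?_, ?_, ?_, ?_⟩
  · intro i j hij
    have hne : e i ≠ e j := e.injective.ne hij
    by_cases h1 : (e i).1 = (e j).1
    · have h2 : (e i).2 ≠ (e j).2 := fun h2 => hne (Prod.ext h1 h2)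
      simp only [Function.onFun]
      rw [h1]
      exact (ht1 _ h2).mono inter_subset_right inter_subset_right
    · exact (disjoint_disjointed _ h1).mono inter_subset_left inter_subset_left
  · exact fun n => (hPm _).inter (ht2 _ _)
  · refine Subset.antisymm (iUnion_subset fun n => inter_subset_left.trans
      ((hPsub _).trans inter_subset_left)) fun x hx => ?_
    rw [← hPU] at hx
    obtain ⟨m, hm⟩ := mem_iUnion.mp hx
    obtain ⟨j, hj⟩ := mem_iUnion.mp (ht3 m hm)
    exact mem_iUnion.mpr ⟨e.symm (m, j), by simpa using ⟨hm, hj⟩⟩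
  · refine fun n => ⟨ht4 _ _, fun x hx => ?_⟩
    obtain ⟨y, hy, hAy⟩ := ht5 (e n).1 ⟨x, hx.1⟩ (e n).2
    refine ⟨?_, y, (hPsub _ hy).1, hAy⟩
    have a1 := (hPsub _ hx.1).2
    have a2 := (hPsub _ hy).2
    simp only [mem_preimage, Metric.mem_ball] at a1 a2
    simp only [hAy]
    rw [← dist_eq_norm]
    linarith [dist_triangle_right (fderiv ℝ f x) (fderiv ℝ f y) (B (e n).1)]

/-- **Area formula** for injective maps with expanding derivatives. -/
theorem euclideanHausdorffMeasure_image_eq_lintegral_normDet {f : U → V} {S : Set U}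
    (hS : MeasurableSet S) (hfc : Continuous f) (hfi : Function.Injective f)
    (hd : ∀ x ∈ S, DifferentiableAt ℝ f x) (hexp : ∀ x ∈ S, ∀ v, ‖v‖ ≤ ‖fderiv ℝ f x v‖) :
    Measure.euclideanHausdorffMeasure (finrank ℝ U) (f '' S) =
      ∫⁻ x in S, ENNReal.ofReal (fderiv ℝ f x).toLinearMap.normDet := by
  have hemb : MeasurableEmbedding f := hfc.measurableEmbedding hfi
  set k := finrank ℝ U
  have key : ∀ c : NNReal, 1 < c →
      Measure.euclideanHausdorffMeasure k (f '' S) ≤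
        (c : ENNReal) ^ (2 * k) *
          ∫⁻ x in S, ENNReal.ofReal (fderiv ℝ f x).toLinearMap.normDet ∧
      ∫⁻ x in S, ENNReal.ofReal (fderiv ℝ f x).toLinearMap.normDet ≤
        (c : ENNReal) ^ (2 * k) * Measure.euclideanHausdorffMeasure k (f '' S) := by
    intro c hc
    have hc' : (1 : ℝ) < c := by exact_mod_cast hc
    have hcp : (0 : ℝ) < c := by linarith
    have hcinv : (c : ℝ)⁻¹ < 1 := inv_lt_one_of_one_lt₀ hc'
    -- This `r` solves `c * (1 - r) = 1`, and `1 + r ≤ c` is then the inequality `c + c⁻¹ ≥ 2`.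
    set r : NNReal := ⟨1 - (c : ℝ)⁻¹, by linarith⟩ with hr
    have hrv : (r : ℝ) = 1 - (c : ℝ)⁻¹ := rfl
    have hr0 : r ≠ 0 := by
      rw [← NNReal.coe_ne_zero, hrv]; linarith
    have h1 : (c : ℝ) * (1 - r) = 1 := by rw [hrv]; field_simp; ring
    have h2 : (1 : ℝ) + r ≤ c := by
      have := r.2
      nlinarith [h1]
    obtain ⟨t, A, tdisj, tmeas, tU, tA⟩ := exists_partition_approximatesLinearOn_fderiv hS hd hr0
    have hpiece : ∀ n, Measure.euclideanHausdorffMeasure k (f '' t n) ≤ (c : ENNReal) ^ (2 * k) *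
          ∫⁻ x in t n, ENNReal.ofReal (fderiv ℝ f x).toLinearMap.normDet ∧
        ∫⁻ x in t n, ENNReal.ofReal (fderiv ℝ f x).toLinearMap.normDet ≤
          (c : ENNReal) ^ (2 * k) * Measure.euclideanHausdorffMeasure k (f '' t n) := fun n => by
      -- Only for a nonempty piece is `A n` known to be a derivative of `f`, and hence expanding.
      rcases (t n).eq_empty_or_nonempty with he | ⟨x, hx⟩
      · simp [he]
      · obtain ⟨-, y, hy, hAy⟩ := (tA n).2 x hx
        exact (tA n).1.area_bounds (by rw [hAy]; exact hexp y hy) (tmeas n) h1 h2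
          fun x hx => ((tA n).2 x hx).1
    have hμ : Measure.euclideanHausdorffMeasure k (f '' S) =
        ∑' n, Measure.euclideanHausdorffMeasure k (f '' t n) := by
      rw [← tU, image_iUnion, measure_iUnion]
      · exact fun i j hij => (disjoint_image_iff hfi).mpr (tdisj hij)
      · exact fun n => hemb.measurableSet_image.mpr (tmeas n)
    have hI : ∫⁻ x in S, ENNReal.ofReal (fderiv ℝ f x).toLinearMap.normDet =
        ∑' n, ∫⁻ x in t n, ENNReal.ofReal (fderiv ℝ f x).toLinearMap.normDet := by
      rw [← tU, lintegral_iUnion tmeas tdisj]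
    rw [hμ, hI, ← ENNReal.tsum_mul_left, ← ENNReal.tsum_mul_left]
    exact ⟨ENNReal.tsum_le_tsum fun n => (hpiece n).1, ENNReal.tsum_le_tsum fun n => (hpiece n).2⟩
  -- The two-sided bounds become equality as `c` decreases to 1.
  have hlim : ∀ b : ENNReal, Filter.Tendsto (fun c : NNReal => (c : ENNReal) ^ (2 * k) * b)
      (𝓝[>] 1) (𝓝 b) := by
    intro b
    have h1 : Filter.Tendsto (fun c : NNReal => (c : ENNReal) ^ (2 * k)) (𝓝[>] 1) (𝓝 1) := by
      have : Continuous fun c : NNReal => (c : ENNReal) ^ (2 * k) := by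
        simp_rw [← ENNReal.coe_pow]
        exact ENNReal.continuous_coe.comp (continuous_pow _)
      simpa using this.tendsto 1 |>.mono_left nhdsWithin_le_nhds
    simpa using ENNReal.Tendsto.mul_const (b := b) h1 (Or.inl one_ne_zero)
  refine le_antisymm (ge_of_tendsto (hlim _) ?_) (ge_of_tendsto (hlim _) ?_)
  · filter_upwards [self_mem_nhdsWithin] with c hc using (key c hc).1
  · filter_upwards [self_mem_nhdsWithin] with c hc using (key c hc).2

end AreaFormula
end

noncomputable section
namespace Advection

variable {d : ℕ}

/-! ### Integration by parts against a Lipschitz function -/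

/-- A compact subset of an open set has a smooth cutoff function. -/
theorem exists_contDiff_cutoff {Ω K : Set (Space d)} (hΩ : IsOpen Ω) (hK : IsClosed K)
    (hKΩ : K ⊆ Ω) :
    ∃ ψ : Space d → ℝ, ContDiff ℝ 1 ψ ∧ (∀ x ∉ Ω, ∀ᶠ y in 𝓝 x, ψ y = 0) ∧
      ∀ x ∈ K, ∀ᶠ y in 𝓝 x, ψ y = 1 := by
  obtain ⟨ψ, h0, h1, -⟩ := exists_contMDiffMap_zero_one_nhds_of_isClosed
    (n := (1 : ℕ∞)) (modelWithCornersSelf ℝ (Space d)) hΩ.isClosed_compl hK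
    (disjoint_compl_left_iff_subset.mpr hKΩ)
  exact ⟨ψ, ψ.contMDiff.contDiff, fun x hx => Filter.Eventually.filter_mono (nhds_le_nhdsSet hx) h0,
    fun x hx => Filter.Eventually.filter_mono (nhds_le_nhdsSet hx) h1⟩

theorem partialDeriv_congr {F : Type*} [NormedAddCommGroup F] [NormedSpace ℝ F] {j : Fin d}
    {f g : Space d → F} {x : Space d} (h : f =ᶠ[𝓝 x] g) :
    partialDeriv j f x = partialDeriv j g x := by
  rw [partialDeriv, partialDeriv, h.fderiv_eq]

theorem divergence_congr {F G : Space d → Space d} {x : Space d} (h : F =ᶠ[𝓝 x] G) :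
    divergence F x = divergence G x :=
  Finset.sum_congr rfl fun j _ => partialDeriv_congr (h.mono fun y hy => by simp [hy])

theorem divergence_zero (x : Space d) : divergence (fun _ => (0 : Space d)) x = 0 := by
  simp [divergence, partialDeriv]

theorem divergence_eq_zero_of_notMem_tsupport {G : Space d → Space d} {x : Space d}
    (h : x ∉ tsupport G) : divergence G x = 0 := by
  rw [divergence_congr (notMem_tsupport_iff_eventuallyEq.mp h)]
  exact divergence_zero x

/-- A linear map applied to a vector, expanded in coordinates. -/
theorem sum_coord_mul_apply_single (L : Space d →L[ℝ] ℝ) (w : Space d) :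
    ∑ j, L (EuclideanSpace.single j 1) * w j = L w := by
  conv_rhs => rw [← (EuclideanSpace.basisFun (Fin d) ℝ).sum_repr w]
  simp [mul_comm]

/-- For a merely Lipschitz `χ`, each coordinate is integrated by parts with directional derivatives;
by Rademacher's theorem these are almost everywhere the components of `fderiv ℝ χ`. -/
theorem integral_mul_divergence_eq_neg_of_contDiff {χ : Space d → ℝ} {C : NNReal}
    (hχ : LipschitzWith C χ) {H : Space d → Space d} (hH : ContDiff ℝ 1 H)
    (hHc : HasCompactSupport H) :
    ∫ x, χ x * divergence H x = -∫ x, fderiv ℝ χ x (H x) := by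
  have hHj : ∀ j, ContDiff ℝ 1 fun x => H x j := fun j => by fun_prop
  have hHjc : ∀ j, HasCompactSupport fun x => H x j := fun j =>
    hHc.comp_left (g := fun v : Space d => v j) rfl
  set e : Fin d → Space d := fun j => EuclideanSpace.single j 1
  have hpj : ∀ j, Continuous (partialDeriv j fun x => H x j) := fun j =>
    ((hHj j).continuous_fderiv one_ne_zero).clm_apply continuous_const
  have hpc : ∀ j, HasCompactSupport (partialDeriv j fun x => H x j) := fun j =>
    (hHjc j).fderiv_apply ℝ (e j)
  have hstep : ∀ j, ∫ x, χ x * partialDeriv j (fun x => H x j) x =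
      -∫ x, lineDeriv ℝ χ x (e j) * H x j := fun j => by
    obtain ⟨D, hD⟩ := (hHj j).lipschitzWith_of_hasCompactSupport (hHjc j) one_ne_zero
    rw [hχ.integral_lineDeriv_mul_eq hD (hHjc j), ← integral_neg]
    refine integral_congr_ae (ae_of_all _ fun x => ?_)
    have := ((hHj j).differentiable one_ne_zero x).lineDeriv_eq_fderiv (v := -e j)
    simp only [this, map_neg, neg_mul, neg_neg, partialDeriv, e]
    ring
  have hint1 : ∀ j, Integrable fun x => χ x * partialDeriv j (fun x => H x j) x := fun j =>
    (hχ.continuous.mul (hpj j)).integrable_of_hasCompactSupport ((hpc j).mul_left)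
  have hint2 : ∀ j, Integrable fun x => lineDeriv ℝ χ x (e j) * H x j := fun j => by
    refine Integrable.bdd_mul (c := C * ‖e j‖)
      ((hHj j).continuous.integrable_of_hasCompactSupport (hHjc j))
      (aestronglyMeasurable_lineDeriv hχ.continuous _) (ae_of_all _ fun x => ?_)
    exact norm_lineDeriv_le_of_lipschitz ℝ hχ
  calc ∫ x, χ x * divergence H x
      = ∫ x, ∑ j, χ x * partialDeriv j (fun x => H x j) x := by
        simp only [divergence, Finset.mul_sum]
    _ = -∫ x, ∑ j, lineDeriv ℝ χ x (e j) * H x j := by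
        rw [integral_finsetSum _ fun j _ => hint1 j, integral_finsetSum _ fun j _ => hint2 j,
          ← Finset.sum_neg_distrib]
        exact Finset.sum_congr rfl fun j _ => hstep j
    _ = -∫ x, fderiv ℝ χ x (H x) := by
        congr 1
        refine integral_congr_ae ?_
        filter_upwards [hχ.ae_differentiableAt] with x hx
        rw [← sum_coord_mul_apply_single]
        exact Finset.sum_congr rfl fun j _ => by rw [hx.lineDeriv_eq_fderiv]

/-- A field that is `C¹` in an open set becomes globally `C¹` after multiplication by a cutoff. -/
theorem contDiff_cutoff_smul {Ω : Set (Space d)} (hΩ : IsOpen Ω) {ψ : Space d → ℝ}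
    (hψ : ContDiff ℝ 1 ψ) (h0 : ∀ x ∉ Ω, ∀ᶠ y in 𝓝 x, ψ y = 0) {G : Space d → Space d}
    (hG : ContDiffOn ℝ 1 G Ω) : ContDiff ℝ 1 fun x => ψ x • G x := by
  rw [contDiff_iff_contDiffAt]
  intro x
  by_cases hx : x ∈ Ω
  · exact hψ.contDiffAt.smul (hG.contDiffAt (hΩ.mem_nhds hx))
  · refine (contDiffAt_const (c := (0 : Space d))).congr_of_eventuallyEq ?_
    filter_upwards [h0 x hx] with y hy
    simp [hy]

/-- **Integration by parts** of the divergence of a field that is `C¹` in `Ω` against a Lipschitz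
function such that the two have no common support outside `Ω`. -/
theorem integral_mul_divergence_eq_neg {Ω : Set (Space d)} (hΩ : IsOpen Ω) {χ : Space d → ℝ}
    {C : NNReal} (hχ : LipschitzWith C χ) {G : Space d → Space d} (hG : ContDiffOn ℝ 1 G Ω)
    (hGc : HasCompactSupport G) (hsupp : tsupport χ ∩ tsupport G ⊆ Ω) :
    ∫ x, χ x * divergence G x = -∫ x, fderiv ℝ χ x (G x) := by
  -- The field `ψ • G` is globally `C¹` since `ψ` vanishes near every point outside `Ω`. Neither
  -- integrand changes, since `ψ = 1` near the common support of `χ` and `G`.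
  obtain ⟨ψ, hψ, h0, h1⟩ := exists_contDiff_cutoff hΩ
    ((isClosed_tsupport χ).inter (isClosed_tsupport G)) hsupp
  have key := integral_mul_divergence_eq_neg_of_contDiff hχ (contDiff_cutoff_smul hΩ hψ h0 hG)
    (hGc.smul_left (f := ψ))
  have hcases : ∀ x, x ∉ tsupport χ ∨ (fun y => ψ y • G y) =ᶠ[𝓝 x] G := by
    intro x
    by_cases hx : x ∈ tsupport χ
    · right
      by_cases hx' : x ∈ tsupport G
      · filter_upwards [h1 x ⟨hx, hx'⟩] with y hy
        simp [hy]
      · filter_upwards [notMem_tsupport_iff_eventuallyEq.mp hx'] with y hy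
        simp [hy]
    · exact Or.inl hx
  convert key using 2
  · ext x
    rcases hcases x with hx | hx
    · simp [image_eq_zero_of_notMem_tsupport hx]
    · rw [divergence_congr hx]
  · refine integral_congr_ae (ae_of_all _ fun x => ?_)
    rcases hcases x with hx | hx
    · have : fderiv ℝ χ x = 0 := by
        rw [(notMem_tsupport_iff_eventuallyEq.mp hx).fderiv_eq]; simp
      simp [this]
    · have hx0 : ψ x • G x = G x := hx.eq_of_nhds
      simp only [hx0]

/-- The divergence of a field of class `C¹` with compact support in `Ω` has integral zero. -/
theorem integral_divergence_eq_zero {Ω : Set (Space d)} (hΩ : IsOpen Ω) {G : Space d → Space d}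
    (hG : ContDiffOn ℝ 1 G Ω) (hGc : HasCompactSupport G) (hsupp : tsupport G ⊆ Ω) :
    ∫ x, divergence G x = 0 := by
  simpa using integral_mul_divergence_eq_neg hΩ (LipschitzWith.const (1 : ℝ)) hG hGc
    (inter_subset_right.trans hsupp)


/-! ### Graph coordinates -/

/-- The hyperplane orthogonal to `e`. -/
abbrev Horizontal (e : Space d) : Type := (Submodule.span ℝ {e})ᗮ

/-- The depth of `x` below the graph of `γ`, with `e` as vertical direction. -/
def depth (e : Space d) (γ : Space d → ℝ) (x : Space d) : ℝ :=
  γ (x - inner ℝ x e • e) - inner ℝ x e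

/-- The point at depth `s` below the point of the graph of `γ` over `y`. -/
def graphPoint (e : Space d) (γ : Space d → ℝ) (s : ℝ) (y : Horizontal e) : Space d :=
  (y : Space d) + (γ y - s) • e

section GraphCoordinates

variable {e : Space d} {γ : Space d → ℝ} {K : NNReal}

theorem inner_horizontal_right (y : Horizontal e) : inner ℝ (y : Space d) e = 0 :=
  Submodule.mem_orthogonal_singleton_iff_inner_left.mp y.2

theorem inner_horizontal_left (y : Horizontal e) : inner ℝ e (y : Space d) = 0 :=
  Submodule.mem_orthogonal_singleton_iff_inner_right.mp y.2

theorem coe_orthogonalProjectionOnto_horizontal (he : ‖e‖ = 1) (x : Space d) :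
    ((Submodule.span ℝ {e})ᗮ.orthogonalProjectionOnto x : Space d) = x - inner ℝ x e • e := by
  rw [← Submodule.starProjection_apply, Submodule.starProjection_orthogonal_val,
    Submodule.starProjection_unit_singleton ℝ he, real_inner_comm]

theorem finrank_horizontal (he : ‖e‖ = 1) : Module.finrank ℝ (Horizontal e) = d - 1 := by
  have h := Submodule.finrank_add_finrank_orthogonal (𝕜 := ℝ) (Submodule.span ℝ {e})
  -- A unit vector exists only for `d ≥ 1`, so the subtraction `d - 1` is not truncated.
  have hne : e ≠ 0 := by rintro rfl; simp at he
  rw [finrank_span_singleton hne, finrank_euclideanSpace_fin] at h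
  change Module.finrank ℝ (Submodule.span ℝ {e})ᗮ = d - 1
  omega

theorem inner_graphPoint (he : ‖e‖ = 1) (s : ℝ) (y : Horizontal e) :
    inner ℝ (graphPoint e γ s y) e = γ y - s := by
  rw [graphPoint, inner_add_left, inner_horizontal_right, real_inner_smul_left,
    real_inner_self_eq_norm_sq, he]
  ring

theorem graphPoint_sub_inner_smul (he : ‖e‖ = 1) (s : ℝ) (y : Horizontal e) :
    graphPoint e γ s y - inner ℝ (graphPoint e γ s y) e • e = y := by
  rw [inner_graphPoint he, graphPoint]; abel

theorem orthogonalProjectionOnto_graphPoint (he : ‖e‖ = 1) (s : ℝ) (y : Horizontal e) :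
    (Submodule.span ℝ {e})ᗮ.orthogonalProjectionOnto (graphPoint e γ s y) = y :=
  Subtype.ext ((coe_orthogonalProjectionOnto_horizontal he _).trans
    (graphPoint_sub_inner_smul he s y))

theorem depth_graphPoint (he : ‖e‖ = 1) (s : ℝ) (y : Horizontal e) :
    depth e γ (graphPoint e γ s y) = s := by
  rw [depth, graphPoint_sub_inner_smul he, inner_graphPoint he]; ring

theorem graphPoint_depth (he : ‖e‖ = 1) (x : Space d) :
    graphPoint e γ (depth e γ x) ((Submodule.span ℝ {e})ᗮ.orthogonalProjectionOnto x) = x := by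
  rw [graphPoint, coe_orthogonalProjectionOnto_horizontal he, depth, sub_sub_cancel]
  abel

theorem graphPoint_eq_add (s : ℝ) (y : Horizontal e) :
    graphPoint e γ s y = graphPoint e γ 0 y + (-s) • e := by
  simp only [graphPoint]; module

theorem depth_add_smul (he : ‖e‖ = 1) (x : Space d) (t : ℝ) :
    depth e γ (x + t • e) = depth e γ x - t := by
  have h : inner ℝ (x + t • e) e = inner ℝ x e + t := by
    rw [inner_add_left, real_inner_smul_left, real_inner_self_eq_norm_sq, he]; ring
  rw [depth, depth, h]
  have : x + t • e - (inner ℝ x e + t) • e = x - inner ℝ x e • e := by module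
  rw [this]; ring

/-- A vertical shift changes the depth by a constant, so the derivative is constant along vertical
lines, including where it takes the default value 0. The layer limit can thus keep the derivative at
the boundary point. -/
theorem fderiv_depth_add_smul (he : ‖e‖ = 1) (x : Space d) (t : ℝ) :
    fderiv ℝ (depth e γ) (x + t • e) = fderiv ℝ (depth e γ) x := by
  rw [← fderiv_comp_add_right]
  simp only [depth_add_smul he, fderiv_sub_const]

theorem fderiv_depth_graphPoint (he : ‖e‖ = 1) (s : ℝ) (y : Horizontal e) :
    fderiv ℝ (depth e γ) (graphPoint e γ s y) = fderiv ℝ (depth e γ) (graphPoint e γ 0 y) := by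
  rw [graphPoint_eq_add, fderiv_depth_add_smul he]

theorem depth_eq_orthogonalProjectionOnto (he : ‖e‖ = 1) : depth e γ = fun x =>
    γ ((Submodule.span ℝ {e})ᗮ.orthogonalProjectionOnto x : Space d) - inner ℝ x e := by
  ext x
  rw [depth, coe_orthogonalProjectionOnto_horizontal he]

theorem lipschitzWith_horizontal_coe :
    LipschitzWith 1 fun y : Horizontal e => (y : Space d) :=
  LipschitzWith.of_edist_le fun _ _ => le_rfl

theorem exists_lipschitzWith_depth (he : ‖e‖ = 1) (hγ : LipschitzWith K γ) :
    ∃ C, LipschitzWith C (depth e γ) := by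
  rw [depth_eq_orthogonalProjectionOnto he]
  have h1 := (hγ.comp lipschitzWith_horizontal_coe).comp
    (Submodule.span ℝ {e})ᗮ.orthogonalProjectionOnto.lipschitz
  have h2 := (innerSL ℝ e).lipschitz
  refine ⟨K * 1 * ‖(Submodule.span ℝ {e})ᗮ.orthogonalProjectionOnto‖₊ + ‖innerSL ℝ e‖₊,
    fun x y => ?_⟩
  simpa [real_inner_comm] using (h1.sub h2) x y

theorem exists_lipschitzWith_graphPoint (hγ : LipschitzWith K γ) :
    ∃ C, LipschitzWith C (graphPoint e γ 0) := by
  have h1 := lipschitzWith_horizontal_coe (e := e)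
  have h2 := (ContinuousLinearMap.toSpanSingleton ℝ e).lipschitz.comp (hγ.comp h1)
  refine ⟨1 + ‖ContinuousLinearMap.toSpanSingleton ℝ e‖₊ * (K * 1), fun x y => ?_⟩
  simpa [graphPoint] using (h1.add h2) x y

theorem continuous_graphPoint (hγ : Continuous γ) :
    Continuous fun p : Horizontal e × ℝ => graphPoint e γ p.2 p.1 := by
  unfold graphPoint
  fun_prop

theorem measurableEmbedding_graphPoint (he : ‖e‖ = 1) (hγ : Continuous γ) :
    MeasurableEmbedding fun p : Horizontal e × ℝ => graphPoint e γ p.2 p.1 := by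
  refine (continuous_graphPoint hγ).measurableEmbedding fun p q h => ?_
  dsimp only at h
  refine Prod.ext ?_ ?_
  · rw [← orthogonalProjectionOnto_graphPoint (γ := γ) he p.2 p.1, h,
      orthogonalProjectionOnto_graphPoint he]
  · rw [← depth_graphPoint (γ := γ) he p.2 p.1, h, depth_graphPoint he]

theorem graphPoint_injective (he : ‖e‖ = 1) (s : ℝ) : Function.Injective (graphPoint e γ s) :=
  fun y z h => by
    rw [← orthogonalProjectionOnto_graphPoint (γ := γ) he s y, h,
      orthogonalProjectionOnto_graphPoint he]

/-- Graph coordinates preserve the volume. -/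
theorem measurePreserving_graphPoint (he : ‖e‖ = 1) (hγ : Continuous γ) :
    MeasurePreserving (fun p : Horizontal e × ℝ => graphPoint e γ p.2 p.1)
      (volume.prod volume) volume := by
  -- Over each `y` the map is a reflection followed by a translation of the line. The rest is the
  -- isometric splitting of the space into the line through `e` and its orthogonal complement.
  have h1 : MeasurePreserving (fun p : Horizontal e × ℝ => (p.1, γ p.1 - p.2))
      (volume.prod volume) (volume.prod volume) := by
    refine (MeasurePreserving.id _).skew_product
      (g := fun (y : Horizontal e) (s : ℝ) => γ y - s) ?_ (ae_of_all _ fun y => ?_)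
    · have : Continuous fun p : Horizontal e × ℝ => γ p.1 - p.2 := by fun_prop
      exact this.measurable
    · exact (Measure.measurePreserving_sub_left volume (γ y)).map_eq
  have h2 : MeasurePreserving (Prod.map (LinearIsometryEquiv.toSpanUnitSingleton (𝕜 := ℝ) e he)
      (id : Horizontal e → Horizontal e)) (volume.prod volume) (volume.prod volume) :=
    (LinearIsometryEquiv.measurePreserving _).prod (MeasurePreserving.id _)
  have h3 := (Submodule.measurePreserving_measurableEquivProd (Submodule.span ℝ {e})
    (0 : Space d)).symm
  rw [InnerProductSpace.euclideanHausdorffMeasure_eq_volume] at h3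
  suffices h4 : (fun p : Horizontal e × ℝ => graphPoint e γ p.2 p.1) =
      ((Submodule.span ℝ {e}).measurableEquivProd (0 : Space d)).symm ∘
        Prod.map (LinearIsometryEquiv.toSpanUnitSingleton (𝕜 := ℝ) e he)
          (id : Horizontal e → Horizontal e) ∘ Prod.swap ∘ fun p => (p.1, γ p.1 - p.2) by
    rw [h4]
    exact h3.comp (h2.comp (Measure.measurePreserving_swap.comp h1))
  ext1 p
  simp only [Function.comp_apply, Prod.swap_prod_mk, Prod.map_apply, id,
    Submodule.measurableEquivProd_symm_apply, LinearIsometryEquiv.toSpanUnitSingleton_apply,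
    vadd_eq_add, add_zero, graphPoint]
  rw [add_comm]

/-- The density of the surface measure of the graph in terms of the horizontal measure. -/
def graphDensity (e : Space d) (γ : Space d → ℝ) (y : Horizontal e) : ℝ :=
  ‖fderiv ℝ (depth e γ) (graphPoint e γ 0 y)‖

theorem measurable_graphDensity (hγ : Continuous γ) : Measurable (graphDensity e γ) := by
  have : Continuous (graphPoint e γ 0) :=
    (continuous_graphPoint hγ).comp (continuous_id.prodMk continuous_const)
  exact ((measurable_fderiv ℝ _).comp this.measurable).norm

theorem ae_differentiableAt_horizontal (hγ : LipschitzWith K γ) :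
    ∀ᵐ y : Horizontal e, DifferentiableAt ℝ (fun z : Horizontal e => γ z) y :=
  (hγ.comp lipschitzWith_horizontal_coe).ae_differentiableAt

/-! ### Tangent map and normal of the graph at a point of differentiability -/

section Differentiable

variable {y : Horizontal e} (hy : DifferentiableAt ℝ (fun z : Horizontal e => γ z) y)
include hy

theorem hasFDerivAt_graphPoint : HasFDerivAt (graphPoint e γ 0)
    ((Submodule.span ℝ {e})ᗮ.subtypeL +
      (fderiv ℝ (fun z : Horizontal e => γ z) y).smulRight e) y := by
  have := ((Submodule.span ℝ {e})ᗮ.subtypeL.hasFDerivAt (x := y)).add (hy.hasFDerivAt.smul_const e)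
  refine this.congr_of_eventuallyEq (Filter.Eventually.of_forall fun z => ?_)
  simp [graphPoint]

/-- With `p` the horizontal gradient of `γ`, the gradient of the depth is `-(e - p)`. Thus `e - p`
points out of the region below the graph, and by orthogonality has length `√(1 + ‖p‖ ^ 2)`. -/
theorem hasFDerivAt_depth (he : ‖e‖ = 1) : HasFDerivAt (depth e γ)
    (-innerSL ℝ (e - ((InnerProductSpace.toDual ℝ (Horizontal e)).symm
      (fderiv ℝ (fun z : Horizontal e => γ z) y) : Space d))) (graphPoint e γ 0 y) := by
  rw [depth_eq_orthogonalProjectionOnto he]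
  have h1 : HasFDerivAt (fun x : Space d =>
      γ ((Submodule.span ℝ {e})ᗮ.orthogonalProjectionOnto x : Space d))
      ((fderiv ℝ (fun z : Horizontal e => γ z) y).comp
        (Submodule.span ℝ {e})ᗮ.orthogonalProjectionOnto) (graphPoint e γ 0 y) := by
    refine HasFDerivAt.comp (g := fun z : Horizontal e => γ z) (graphPoint e γ 0 y) ?_
      ((Submodule.span ℝ {e})ᗮ.orthogonalProjectionOnto.hasFDerivAt)
    rw [orthogonalProjectionOnto_graphPoint he]
    exact hy.hasFDerivAt
  have h2 := (innerSL ℝ e).hasFDerivAt (x := graphPoint e γ 0 y)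
  have h3 := h1.sub h2
  refine (h3.congr_of_eventuallyEq (Filter.Eventually.of_forall fun x => ?_)).congr_fderiv ?_
  · simp [real_inner_comm]
  · ext x
    set p := (InnerProductSpace.toDual ℝ (Horizontal e)).symm
      (fderiv ℝ (fun z : Horizontal e => γ z) y) with hp
    have h4 : fderiv ℝ (fun z : Horizontal e => γ z) y
        ((Submodule.span ℝ {e})ᗮ.orthogonalProjectionOnto x) = inner ℝ (p : Space d) x := by
      rw [← InnerProductSpace.toDual_symm_apply, ← hp, Submodule.coe_inner,
        coe_orthogonalProjectionOnto_horizontal he, inner_sub_right, real_inner_smul_right,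
        inner_horizontal_right]
      ring
    simp [h4]

theorem graphDensity_eq (he : ‖e‖ = 1) : graphDensity e γ y =
    √(1 + ‖(InnerProductSpace.toDual ℝ (Horizontal e)).symm
      (fderiv ℝ (fun z : Horizontal e => γ z) y)‖ ^ 2) := by
  rw [graphDensity, (hasFDerivAt_depth hy he).fderiv, norm_neg, innerSL_apply_norm,
    ← Real.sqrt_sq (norm_nonneg (e - _)), norm_sub_sq_real, he, inner_horizontal_left,
    Submodule.coe_norm]
  congr 1
  ring

/-- The tangential Jacobian of the graph map equals the length of the normal `e - p`; this is why
the surface density cancels the normalisation of the outward normal. -/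
theorem normDet_fderiv_graphPoint (he : ‖e‖ = 1) :
    (fderiv ℝ (graphPoint e γ 0) y).toLinearMap.normDet = graphDensity e γ y := by
  rw [graphDensity_eq hy he, (hasFDerivAt_graphPoint hy).fderiv]
  exact LinearMap.normDet_graph (L := (Submodule.span ℝ {e})ᗮ.subtypeₗᵢ) he
    (fun v => inner_horizontal_right v) fun v => by
      rw [InnerProductSpace.toDual_symm_apply]; simp

/-- The horizontal component of the image is `v` itself. This is the expansion hypothesis of the
area formula. -/
theorem norm_le_norm_fderiv_graphPoint (v : Horizontal e) :
    ‖v‖ ≤ ‖fderiv ℝ (graphPoint e γ 0) y v‖ := by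
  rw [(hasFDerivAt_graphPoint hy).fderiv, ← sq_le_sq₀ (norm_nonneg _) (norm_nonneg _)]
  simp only [add_apply, Submodule.subtypeL_apply,
    ContinuousLinearMap.smulRight_apply]
  rw [norm_add_sq_real, real_inner_smul_right, inner_horizontal_right, Submodule.coe_norm]
  nlinarith [sq_nonneg ‖fderiv ℝ (fun z : Horizontal e => γ z) y v • e‖]

end Differentiable

/-- The surface measure of a Lipschitz graph in graph coordinates. -/
theorem map_graphPoint_withDensity (he : ‖e‖ = 1) (hγ : LipschitzWith K γ) :
    Measure.map (graphPoint e γ 0)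
        (volume.withDensity fun y => ENNReal.ofReal (graphDensity e γ y)) =
      (Measure.euclideanHausdorffMeasure (d - 1)).restrict (range (graphPoint e γ 0)) := by
  obtain ⟨C, hC⟩ := exists_lipschitzWith_graphPoint (e := e) hγ
  have hemb := hC.continuous.measurableEmbedding (graphPoint_injective he 0)
  ext S hS
  rw [hemb.map_apply, Measure.restrict_apply hS, inter_comm, ← image_preimage_eq_range_inter,
    withDensity_apply _ (hemb.measurable hS)]
  set T := graphPoint e γ 0 ⁻¹' S
  have hT : MeasurableSet T := hemb.measurable hS
  set D := {y : Horizontal e | DifferentiableAt ℝ (fun z : Horizontal e => γ z) y}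
  have hD : MeasurableSet D := measurableSet_of_differentiableAt ℝ _
  have hD0 : volume Dᶜ = 0 := ae_differentiableAt_horizontal hγ
  -- Lipschitz maps preserve null sets, so the points where `γ` is not differentiable contribute no
  -- surface.
  have hnull : Measure.euclideanHausdorffMeasure (d - 1) (graphPoint e γ 0 '' (T \ D)) = 0 := by
    have h := Measure.euclideanHausdorffMeasure_image_le_of_dist_le (f := graphPoint e γ 0)
      (g := id) (S := T \ D) (c := C) (fun x _ y _ => hC.dist_le_mul x y) (d - 1)
    rw [image_id, ← finrank_horizontal he, InnerProductSpace.euclideanHausdorffMeasure_eq_volume,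
      measure_mono_null (sdiff_subset_compl T D) hD0, mul_zero, finrank_horizontal he] at h
    exact nonpos_iff_eq_zero.mp h
  have h1 : Measure.euclideanHausdorffMeasure (d - 1) (graphPoint e γ 0 '' T) =
      Measure.euclideanHausdorffMeasure (d - 1) (graphPoint e γ 0 '' (T ∩ D)) := by
    rw [← inter_union_sdiff T D, image_union, inter_union_sdiff]
    exact measure_congr (union_ae_eq_left_of_ae_eq_empty (ae_eq_empty.mpr hnull))
  rw [h1, ← finrank_horizontal he, euclideanHausdorffMeasure_image_eq_lintegral_normDet
    (hT.inter hD) hC.continuous (graphPoint_injective he 0)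
    (fun y hy => (hasFDerivAt_graphPoint hy.2).differentiableAt)
    (fun y hy => norm_le_norm_fderiv_graphPoint hy.2)]
  rw [setLIntegral_congr_fun (hT.inter hD) fun y hy => by
    rw [normDet_fderiv_graphPoint hy.2 he]]
  refine setLIntegral_congr ?_
  exact (inter_ae_eq_left_of_ae_eq_univ (ae_eq_univ.mpr hD0)).symm

end GraphCoordinates

/-! ### The outward normal at regular boundary points -/

/-- Where a defining function of the boundary is differentiable with nonzero derivative, its
normalised negative gradient is the outward unit normal. -/
theorem isOutwardUnitNormal_of_hasFDerivAt {Ω U : Set (Space d)} {ρ : Space d → ℝ} {x N : Space d}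
    (hU : U ∈ 𝓝 x) (hΩ : ∀ z ∈ U, z ∈ Ω ↔ 0 < ρ z) (hx : ρ x = 0)
    (hρ : HasFDerivAt ρ (-innerSL ℝ N) x) (hN : N ≠ 0) :
    IsOutwardUnitNormal Ω x (‖N‖⁻¹ • N) := by
  have hN0 : 0 < ‖N‖ := norm_pos_iff.mpr hN
  refine ⟨by rw [norm_smul, norm_inv, norm_norm, inv_mul_cancel₀ hN0.ne'], fun ε hε => ?_⟩
  -- The tolerance `ε * ‖N‖` becomes `ε` after the normal is divided by `‖N‖`.
  have hev := (Asymptotics.isLittleO_iff.mp hρ.isLittleO) (mul_pos hε hN0)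
  filter_upwards [hev, hU] with y hy hyU
  rw [hx, sub_zero, Real.norm_eq_abs, abs_le] at hy
  simp only [neg_apply, innerSL_apply_apply, sub_neg_eq_add] at hy
  have hin : inner ℝ (y - x) (‖N‖⁻¹ • N) = ‖N‖⁻¹ * inner ℝ N (y - x) := by
    rw [real_inner_smul_right, real_inner_comm]
  have hin' : inner ℝ N (y - x) = ‖N‖ * inner ℝ (y - x) (‖N‖⁻¹ • N) := by
    rw [hin]; field_simp
  rw [hΩ y hyU]
  rw [hin'] at hy
  constructor
  · intro h
    have := mul_lt_mul_of_pos_left h hN0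
    linarith
  · intro h
    have := mul_lt_mul_of_pos_left h hN0
    linarith

theorem outwardNormal_eq {Ω : Set (Space d)} {x n : Space d} (h : IsOutwardUnitNormal Ω x n) :
    outwardNormal Ω x = n := by
  have hex : ∃ n, IsOutwardUnitNormal Ω x n := ⟨n, h⟩
  rw [outwardNormal, dif_pos hex]
  exact hex.choose_spec.unique h


/-! ### Fields that are `C¹` up to the boundary -/

section UpToBoundary

variable {Ω : Set (Space d)} {G : Space d → Space d}

theorem IsC1UpToBoundary.contDiffOn (hΩ : IsOpen Ω) (hG : IsC1UpToBoundary Ω G) :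
    ContDiffOn ℝ 1 G Ω := by
  obtain ⟨-, D, hD, hGD⟩ := hG
  refine (contDiffOn_succ_iff_hasFDerivWithinAt_of_uniqueDiffOn (n := 0) hΩ.uniqueDiffOn).mpr
    ⟨by simp, D, contDiffOn_zero.mpr (hD.mono subset_closure),
      fun x hx => (hGD x hx).hasFDerivWithinAt⟩

theorem partialDeriv_coord {x : Space d} {D : Space d →L[ℝ] Space d} (h : HasFDerivAt G D x)
    (i j : Fin d) : partialDeriv j (fun y => G y i) x = D (EuclideanSpace.single j 1) i := by
  have h1 : HasFDerivAt (fun y => G y i) ((EuclideanSpace.proj i : Space d →L[ℝ] ℝ).comp D) x :=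
    (EuclideanSpace.proj i : Space d →L[ℝ] ℝ).hasFDerivAt.comp x h
  rw [partialDeriv, h1.fderiv]
  simp

theorem divergence_eq_of_hasFDerivAt {x : Space d} {D : Space d →L[ℝ] Space d}
    (h : HasFDerivAt G D x) : divergence G x = ∑ j, D (EuclideanSpace.single j 1) j :=
  Finset.sum_congr rfl fun j _ => partialDeriv_coord h j j

theorem integrableOn_of_continuousOn_closure {E : Type*} [NormedAddCommGroup E]
    {f g : Space d → E} (hΩ : IsOpen Ω) (hb : Bornology.IsBounded Ω)
    (hf : ContinuousOn f (closure Ω)) (hfg : EqOn g f Ω) : IntegrableOn g Ω :=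
  ((hf.integrableOn_compact hb.isCompact_closure).mono_set subset_closure).congr_fun hfg.symm
    hΩ.measurableSet

theorem continuousOn_sum_apply_single {S : Set (Space d)} {D : Space d → Space d →L[ℝ] Space d}
    (hD : ContinuousOn D S) :
    ContinuousOn (fun x => ∑ j, D x (EuclideanSpace.single j 1) j) S :=
  continuousOn_finsetSum _ fun j _ =>
    (EuclideanSpace.proj j : Space d →L[ℝ] ℝ).continuous.comp_continuousOn
      (hD.clm_apply continuousOn_const)

theorem IsC1UpToBoundary.integrableOn_divergence (hΩ : IsOpen Ω) (hb : Bornology.IsBounded Ω)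
    (hG : IsC1UpToBoundary Ω G) : IntegrableOn (divergence G) Ω := by
  obtain ⟨-, D, hD, hGD⟩ := hG
  exact integrableOn_of_continuousOn_closure hΩ hb (continuousOn_sum_apply_single hD)
    fun x hx => divergence_eq_of_hasFDerivAt (hGD x hx)

end UpToBoundary

/-! ### Layers below a Lipschitz graph -/

section Layers

variable {e : Space d} {γ : Space d → ℝ} {K : NNReal}

/-- The cutoff that vanishes up to depth `ε` and equals `1` from depth `2ε` on. -/
def depthCutoff (e : Space d) (γ : Space d → ℝ) (ε : ℝ) (x : Space d) : ℝ :=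
  max 0 (min 1 (ε⁻¹ * depth e γ x - 1))

theorem depthCutoff_nonneg (ε : ℝ) (x : Space d) : 0 ≤ depthCutoff e γ ε x := le_max_left _ _

theorem depthCutoff_le_one (ε : ℝ) (x : Space d) : depthCutoff e γ ε x ≤ 1 :=
  max_le zero_le_one (min_le_left _ _)

theorem depthCutoff_of_le {ε : ℝ} (hε : 0 < ε) {x : Space d} (h : depth e γ x ≤ ε) :
    depthCutoff e γ ε x = 0 := by
  have : ε⁻¹ * depth e γ x ≤ 1 := by rwa [inv_mul_le_iff₀ hε, mul_one]
  exact max_eq_left ((min_le_right _ _).trans (by linarith))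

theorem depthCutoff_of_ge {ε : ℝ} (hε : 0 < ε) {x : Space d} (h : 2 * ε ≤ depth e γ x) :
    depthCutoff e γ ε x = 1 := by
  have : 2 ≤ ε⁻¹ * depth e γ x := by rw [le_inv_mul_iff₀ hε]; linarith
  rw [depthCutoff, min_eq_left (by linarith), max_eq_right zero_le_one]

theorem depthCutoff_of_mem {ε : ℝ} (hε : 0 < ε) {x : Space d}
    (h : depth e γ x ∈ Ioo ε (2 * ε)) : depthCutoff e γ ε x = ε⁻¹ * depth e γ x - 1 := by
  have h1 : 1 ≤ ε⁻¹ * depth e γ x := by rw [le_inv_mul_iff₀ hε]; linarith [h.1]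
  have h2 : ε⁻¹ * depth e γ x ≤ 2 := by rw [inv_mul_le_iff₀ hε]; linarith [h.2]
  rw [depthCutoff, min_eq_right (by linarith), max_eq_right (by linarith)]

theorem exists_lipschitzWith_depthCutoff (he : ‖e‖ = 1) (hγ : LipschitzWith K γ) (ε : ℝ) :
    ∃ C, LipschitzWith C (depthCutoff e γ ε) := by
  obtain ⟨C, hC⟩ := exists_lipschitzWith_depth he hγ
  have h1 : LipschitzWith (‖ε⁻¹‖₊ * C) fun x => ε⁻¹ * depth e γ x - 1 := by
    refine LipschitzWith.of_dist_le_mul fun x y => ?_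
    have := hC.dist_le_mul x y
    rw [Real.dist_eq] at this ⊢
    rw [sub_sub_sub_cancel_right, ← mul_sub, abs_mul, NNReal.coe_mul, mul_assoc]
    exact mul_le_mul_of_nonneg_left this (abs_nonneg _)
  exact ⟨_, (h1.const_min 1).const_max 0⟩

theorem continuous_depth (he : ‖e‖ = 1) (hγ : LipschitzWith K γ) : Continuous (depth e γ) :=
  (exists_lipschitzWith_depth he hγ).choose_spec.continuous

/-- This is why the cutoff starts at depth `ε` rather than 0: its closed support, within a chart,
lies in `Ω`, where the field is `C¹`. -/
theorem tsupport_depthCutoff_subset (he : ‖e‖ = 1) (hγ : LipschitzWith K γ) {ε : ℝ}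
    (hε : 0 < ε) : tsupport (depthCutoff e γ ε) ⊆ {x | ε ≤ depth e γ x} := by
  refine closure_minimal (fun x hx => ?_) (isClosed_le continuous_const (continuous_depth he hγ))
  by_contra h
  exact hx (depthCutoff_of_le hε (not_le.mp h).le)

theorem volume_depth_eq (he : ‖e‖ = 1) (hγ : LipschitzWith K γ) (c : ℝ) :
    volume {x : Space d | depth e γ x = c} = 0 := by
  have hm : MeasurableSet {x : Space d | depth e γ x = c} :=
    (isClosed_eq (continuous_depth he hγ) continuous_const).measurableSet
  rw [← (measurePreserving_graphPoint he hγ.continuous).measure_preimage hm.nullMeasurableSet]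
  have : (fun p : Horizontal e × ℝ => graphPoint e γ p.2 p.1) ⁻¹' {x | depth e γ x = c} =
      univ ×ˢ {c} := by
    ext p
    simp [depth_graphPoint he]
  rw [this, Measure.prod_prod]
  simp

/-- Off the null levels `ε` and `2 * ε` the cutoff is locally constant or locally affine in the
depth. No differentiability of the depth is needed: where it fails, both sides are 0. -/
theorem ae_fderiv_depthCutoff (he : ‖e‖ = 1) (hγ : LipschitzWith K γ) {ε : ℝ} (hε : 0 < ε) :
    ∀ᵐ x : Space d, ∀ w, fderiv ℝ (depthCutoff e γ ε) x w =
      ε⁻¹ * (Ioo 1 2).indicator (fun _ => fderiv ℝ (depth e γ) x w) (ε⁻¹ * depth e γ x) := by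
  have hc := continuous_depth he hγ
  filter_upwards [compl_mem_ae_iff.mpr (volume_depth_eq he hγ ε),
    compl_mem_ae_iff.mpr (volume_depth_eq he hγ (2 * ε))] with x h1 h2 w
  have h1 : depth e γ x ≠ ε := h1
  have h2 : depth e γ x ≠ 2 * ε := h2
  have e1 : 1 < ε⁻¹ * depth e γ x ↔ ε < depth e γ x := by rw [lt_inv_mul_iff₀ hε, mul_one]
  have e2 : ε⁻¹ * depth e γ x < 2 ↔ depth e γ x < 2 * ε := by
    rw [inv_mul_lt_iff₀ hε, mul_comm]
  rcases lt_or_gt_of_ne h1 with h1 | h1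
  · have : depthCutoff e γ ε =ᶠ[𝓝 x] fun _ => 0 := by
      filter_upwards [hc.continuousAt.eventually_lt continuousAt_const h1] with z hz
      exact depthCutoff_of_le hε hz.le
    rw [this.fderiv_eq, indicator_of_notMem (by rw [mem_Ioo, e1]; exact fun h => absurd h.1 h1.not_gt)]
    simp
  rcases lt_or_gt_of_ne h2 with h2 | h2
  · have : depthCutoff e γ ε =ᶠ[𝓝 x] fun z => ε⁻¹ * depth e γ z - 1 := by
      filter_upwards [hc.continuousAt.eventually_lt continuousAt_const h2,
        continuousAt_const.eventually_lt hc.continuousAt h1] with z hz hz'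
      exact depthCutoff_of_mem hε ⟨hz', hz⟩
    rw [this.fderiv_eq, indicator_of_mem (by rw [mem_Ioo, e1, e2]; exact ⟨h1, h2⟩),
      fderiv_sub_const]
    change fderiv ℝ (ε⁻¹ • depth e γ) x w = _
    rw [fderiv_const_smul_field]
    simp
  · have : depthCutoff e γ ε =ᶠ[𝓝 x] fun _ => 1 := by
      filter_upwards [continuousAt_const.eventually_lt hc.continuousAt h2] with z hz
      exact depthCutoff_of_ge hε hz.le
    rw [this.fderiv_eq, indicator_of_notMem (by rw [mem_Ioo, e2]; exact fun h => absurd h.2 h2.not_gt)]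
    simp

/-- Integration in graph coordinates with rescaled depth. -/
theorem integral_graphPoint_mul (he : ‖e‖ = 1) (hγ : Continuous γ) {ε : ℝ} (hε : 0 < ε)
    (h : Space d → ℝ) :
    ∫ p : Horizontal e × ℝ, h (graphPoint e γ (ε * p.2) p.1) ∂(volume.prod volume) =
      ε⁻¹ * ∫ x, h x := by
  have hemb : MeasurableEmbedding (Prod.map (id : Horizontal e → Horizontal e) (ε * ·)) :=
    MeasurableEmbedding.id.prodMap (measurableEmbedding_mulLeft₀ hε.ne')
  have hmap : Measure.map (Prod.map (id : Horizontal e → Horizontal e) (ε * ·))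
      (volume.prod volume) = ENNReal.ofReal |ε⁻¹| • (volume.prod volume) := by
    rw [← Measure.map_prod_map _ _ measurable_id (measurable_const_mul ε), Measure.map_id,
      Real.map_volume_mul_left hε.ne', Measure.prod_smul_right]
  have h1 := hemb.integral_map (μ := volume.prod volume)
    fun p : Horizontal e × ℝ => h (graphPoint e γ p.2 p.1)
  rw [hmap, integral_smul_measure,
    (measurePreserving_graphPoint he hγ).integral_comp (measurableEmbedding_graphPoint he hγ)] at h1
  refine h1.symm.trans ?_
  rw [ abs_of_pos (inv_pos.mpr hε), ENNReal.toReal_ofReal (inv_pos.mpr hε).le, smul_eq_mul]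

end Layers


/-! ### The divergence theorem in a boundary chart -/

/-- In the open set `U`, the set `Ω` is the region below the graph of the Lipschitz function `γ`,
with `e` as vertical direction. -/
structure IsGraphChart (Ω U : Set (Space d)) (e : Space d) (K : NNReal) (γ : Space d → ℝ) :
    Prop where
  norm_eq_one : ‖e‖ = 1
  lipschitz : LipschitzWith K γ
  isOpen : IsOpen U
  mem_iff : ∀ x ∈ U, x ∈ Ω ↔ 0 < depth e γ x

theorem HasLipschitzBoundary.exists_isGraphChart {Ω : Set (Space d)}
    (h : HasLipschitzBoundary Ω) {p : Space d} (hp : p ∈ frontier Ω) :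
    ∃ U e K γ, p ∈ U ∧ IsGraphChart Ω U e K γ := by
  obtain ⟨e, K, γ, U, he, hγ, hU, hpU, hΩ⟩ := h p hp
  exact ⟨U, e, K, γ, hpU, he, hγ, hU, fun x hx => by rw [hΩ x hx, depth, sub_pos]⟩

namespace IsGraphChart

variable {Ω U : Set (Space d)} {e : Space d} {K : NNReal} {γ : Space d → ℝ}

/-- Moving from `x` slightly in the direction `-e` makes the depth positive, so it enters `Ω`. -/
theorem mem_closure_of_depth_eq_zero (h : IsGraphChart Ω U e K γ) {x : Space d} (hx : x ∈ U)
    (h0 : depth e γ x = 0) : x ∈ closure Ω := by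
  have hc : ContinuousAt (fun t : ℝ => x + t • e) 0 := by fun_prop
  have hU : ∀ᶠ t : ℝ in 𝓝[<] 0, x + t • e ∈ U := by
    refine (hc.eventually_mem ?_).filter_mono nhdsWithin_le_nhds
    simpa using h.isOpen.mem_nhds hx
  refine mem_closure_of_tendsto (b := 𝓝[<] (0 : ℝ)) (f := fun t : ℝ => x + t • e) ?_ ?_
  · simpa using hc.tendsto.mono_left nhdsWithin_le_nhds
  · filter_upwards [hU, self_mem_nhdsWithin] with t ht ht0
    rw [h.mem_iff _ ht, depth_add_smul h.norm_eq_one, h0]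
    simpa using ht0

theorem mem_frontier_iff (h : IsGraphChart Ω U e K γ) (hΩ : IsOpen Ω) {x : Space d}
    (hx : x ∈ U) : x ∈ frontier Ω ↔ depth e γ x = 0 := by
  rw [hΩ.frontier_eq]
  constructor
  · rintro ⟨hcl, hn⟩
    rw [h.mem_iff x hx, not_lt] at hn
    refine hn.antisymm (not_lt.mp fun hlt => ?_)
    have hev : ∀ᶠ z in 𝓝 x, z ∈ U ∧ depth e γ z < 0 :=
      (h.isOpen.eventually_mem hx).and
        ((continuous_depth h.norm_eq_one h.lipschitz).continuousAt.eventually_lt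
          continuousAt_const hlt)
    obtain ⟨z, hz, hzΩ⟩ := mem_closure_iff_nhds.mp hcl _ hev
    exact absurd ((h.mem_iff z hz.1).mp hzΩ) hz.2.not_gt
  · intro h0
    exact ⟨h.mem_closure_of_depth_eq_zero hx h0, by rw [h.mem_iff x hx, h0]; exact lt_irrefl 0⟩

theorem graphPoint_mem_closure (h : IsGraphChart Ω U e K γ) {s : ℝ} (hs : 0 ≤ s)
    {y : Horizontal e} (hx : graphPoint e γ s y ∈ U) : graphPoint e γ s y ∈ closure Ω := by
  rcases hs.eq_or_lt with rfl | hs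
  · exact h.mem_closure_of_depth_eq_zero hx (depth_graphPoint h.norm_eq_one _ _)
  · exact subset_closure ((h.mem_iff _ hx).mpr (by rwa [depth_graphPoint h.norm_eq_one]))

variable {G : Space d → Space d}

/-- At each point of `Ω` in the support of `G` the cutoff is eventually 1, and `|∇·G|` on `Ω`
dominates. Outside `Ω` nothing is known about `∇·G`, but there either the cutoff or the field
vanishes. -/
theorem tendsto_integral_depthCutoff_mul (h : IsGraphChart Ω U e K γ) (hΩ : IsOpen Ω)
    (hGi : IntegrableOn (divergence G) Ω) (hGU : tsupport G ⊆ U) :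
    Filter.Tendsto (fun ε => ∫ x, depthCutoff e γ ε x * divergence G x) (𝓝[>] 0)
      (𝓝 (∫ x in Ω, divergence G x)) := by
  have hI : Integrable (Ω.indicator (divergence G)) := hGi.integrable_indicator hΩ.measurableSet
  have key : Filter.Tendsto
      (fun ε => ∫ x, depthCutoff e γ ε x * Ω.indicator (divergence G) x) (𝓝[>] 0)
      (𝓝 (∫ x, Ω.indicator (divergence G) x)) := by
    refine tendsto_integral_filter_of_dominated_convergence
      (fun x => ‖Ω.indicator (divergence G) x‖) (Filter.Eventually.of_forall fun ε => ?_)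
      (Filter.Eventually.of_forall fun ε => ae_of_all _ fun x => ?_) hI.norm
      (ae_of_all _ fun x => ?_)
    · obtain ⟨C, hC⟩ := exists_lipschitzWith_depthCutoff h.norm_eq_one h.lipschitz ε
      exact hC.continuous.aestronglyMeasurable.mul hI.aestronglyMeasurable
    · rw [norm_mul, Real.norm_of_nonneg (depthCutoff_nonneg ε x)]
      exact mul_le_of_le_one_left (norm_nonneg _) (depthCutoff_le_one ε x)
    · by_cases hx : x ∈ Ω ∧ x ∈ tsupport G
      · have hpos : 0 < depth e γ x := (h.mem_iff x (hGU hx.2)).mp hx.1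
        refine tendsto_const_nhds.congr' ?_
        have hlt : ∀ᶠ ε : ℝ in 𝓝[>] 0, ε < depth e γ x / 2 :=
          nhdsWithin_le_nhds (Iio_mem_nhds (by positivity))
        filter_upwards [hlt, self_mem_nhdsWithin] with ε h1 h2
        rw [depthCutoff_of_ge h2 (by linarith), one_mul]
      · have h0 : Ω.indicator (divergence G) x = 0 := by
          by_cases hxΩ : x ∈ Ω
          · rw [indicator_of_mem hxΩ, divergence_eq_zero_of_notMem_tsupport fun hx' => hx ⟨hxΩ, hx'⟩]
          · exact indicator_of_notMem hxΩ _
        simp [h0]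
  rw [integral_indicator hΩ.measurableSet] at key
  refine key.congr' ?_
  filter_upwards [self_mem_nhdsWithin] with ε hε
  refine integral_congr_ae (ae_of_all _ fun x => ?_)
  dsimp only
  by_cases hxΩ : x ∈ Ω
  · rw [indicator_of_mem hxΩ]
  rw [indicator_of_notMem hxΩ, mul_zero]
  by_cases hxG : x ∈ tsupport G
  · rw [h.mem_iff x (hGU hxG), not_lt] at hxΩ
    rw [depthCutoff_of_le hε (hxΩ.trans hε.le), zero_mul]
  · rw [divergence_eq_zero_of_notMem_tsupport hxG, mul_zero]

/-- At nonnegative depth, a field supported in the chart agrees with its restriction to the closure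
of `Ω`. -/
theorem indicator_closure_graphPoint (h : IsGraphChart Ω U e K γ) (hGU : tsupport G ⊆ U) {s : ℝ}
    (hs : 0 ≤ s) (y : Horizontal e) :
    (closure Ω).indicator G (graphPoint e γ s y) = G (graphPoint e γ s y) := by
  by_cases hx : graphPoint e γ s y ∈ tsupport G
  · exact indicator_of_mem (h.graphPoint_mem_closure hs (hGU hx)) _
  · rw [indicator_apply_eq_self.mpr fun _ => image_eq_zero_of_notMem_tsupport hx]

/-- Off `closure Ω` the field is arbitrary, possibly not measurable; the indicator is a globally
measurable substitute. -/
theorem measurable_indicator_closure (hG : ContinuousOn G (closure Ω)) :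
    Measurable ((closure Ω).indicator G) := by
  classical
  rw [← piecewise_eq_indicator]
  exact hG.measurable_piecewise continuousOn_const isClosed_closure.measurableSet

theorem aestronglyMeasurable_fderiv_depth_apply (hγ : Continuous γ) {α : Type*}
    [MeasurableSpace α] {μ : Measure α} {y : α → Horizontal e} (hy : Measurable y)
    {w : α → Space d} (hw : Measurable w) :
    AEStronglyMeasurable (fun p => fderiv ℝ (depth e γ) (graphPoint e γ 0 (y p)) (w p)) μ := by
  have hc : Continuous (graphPoint e γ 0) :=
    (continuous_graphPoint hγ).comp (continuous_id.prodMk continuous_const)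
  have h1 : Measurable fun p => fderiv ℝ (depth e γ) (graphPoint e γ 0 (y p)) :=
    (measurable_fderiv ℝ _).comp (hc.measurable.comp hy)
  exact (ContinuousLinearMap.id ℝ (Space d →L[ℝ] ℝ)).aestronglyMeasurable_comp₂
    h1.aestronglyMeasurable hw.aestronglyMeasurable

/-- The bound is the Lipschitz constant of the depth times the maximum of `G` on the compact
closure. The points `x` and `z` are separate because the layer integrals evaluate the field at depth
`εσ` but the derivative at depth 0. -/
theorem exists_norm_fderiv_depth_apply_le (h : IsGraphChart Ω U e K γ) (hb : Bornology.IsBounded Ω)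
    (hG : ContinuousOn G (closure Ω)) : ∃ B, 0 ≤ B ∧ ∀ x z : Space d,
      ‖fderiv ℝ (depth e γ) z ((closure Ω).indicator G x)‖ ≤ B := by
  obtain ⟨C, hC⟩ := exists_lipschitzWith_depth h.norm_eq_one h.lipschitz
  obtain ⟨M, hM⟩ := hb.isCompact_closure.exists_bound_of_continuousOn hG
  refine ⟨C * max M 0, by positivity, fun x z => ?_⟩
  refine ((fderiv ℝ (depth e γ) z).le_of_opNorm_le (norm_fderiv_le_of_lipschitz ℝ hC) _).trans ?_
  gcongr
  by_cases hx : x ∈ closure Ω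
  · rw [indicator_of_mem hx]
    exact (hM x hx).trans (le_max_left _ _)
  · rw [indicator_of_notMem hx, norm_zero]
    exact le_max_right _ _

theorem isCompact_projection_tsupport (hGc : HasCompactSupport G) :
    IsCompact ((Submodule.span ℝ {e})ᗮ.orthogonalProjectionOnto '' tsupport G) :=
  hGc.isCompact.image (ContinuousLinearMap.continuous _)

theorem integrable_fderiv_depth_graphPoint (h : IsGraphChart Ω U e K γ)
    (hb : Bornology.IsBounded Ω) (hG : ContinuousOn G (closure Ω)) (hGc : HasCompactSupport G)
    (hGU : tsupport G ⊆ U) : Integrable fun y : Horizontal e =>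
      fderiv ℝ (depth e γ) (graphPoint e γ 0 y) (G (graphPoint e γ 0 y)) := by
  obtain ⟨B, hB0, hB⟩ := h.exists_norm_fderiv_depth_apply_le hb hG
  have hc : Continuous (graphPoint e γ 0) :=
    (continuous_graphPoint h.lipschitz.continuous).comp (continuous_id.prodMk continuous_const)
  set T := (Submodule.span ℝ {e})ᗮ.orthogonalProjectionOnto '' tsupport G with hT
  have hTc : IsCompact T := isCompact_projection_tsupport hGc
  have hbound : Integrable (T.indicator fun _ : Horizontal e => B) :=
    (integrable_indicator_iff hTc.measurableSet).mpr
      (integrableOn_const hTc.measure_lt_top.ne)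
  simp_rw [← h.indicator_closure_graphPoint hGU le_rfl]
  refine hbound.mono' (aestronglyMeasurable_fderiv_depth_apply h.lipschitz.continuous measurable_id
    ((measurable_indicator_closure hG).comp hc.measurable)) (ae_of_all _ fun y => ?_)
  by_cases hy : y ∈ T
  · rw [indicator_of_mem hy]
    exact hB _ _
  · have hy' : graphPoint e γ 0 y ∉ tsupport G := fun hx => hy
      ⟨_, hx, orthogonalProjectionOnto_graphPoint h.norm_eq_one 0 y⟩
    rw [h.indicator_closure_graphPoint hGU le_rfl, image_eq_zero_of_notMem_tsupport hy',
      indicator_of_notMem hy]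
    simp

/-- Continuity on `closure Ω` suffices. If the boundary point is in the support of `G`, nearby
points at positive depth stay in the chart, hence in `closure Ω`; otherwise `G` vanishes nearby. -/
theorem tendsto_graphPoint (h : IsGraphChart Ω U e K γ) (hG : ContinuousOn G (closure Ω))
    (hGU : tsupport G ⊆ U) (y : Horizontal e) {σ : ℝ} (hσ : 0 < σ) :
    Filter.Tendsto (fun ε => G (graphPoint e γ (ε * σ) y)) (𝓝[>] 0)
      (𝓝 (G (graphPoint e γ 0 y))) := by
  have hc : Continuous fun ε : ℝ => graphPoint e γ (ε * σ) y :=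
    (continuous_graphPoint h.lipschitz.continuous).comp
      (continuous_const.prodMk (continuous_id.mul continuous_const))
  have ht : Filter.Tendsto (fun ε : ℝ => graphPoint e γ (ε * σ) y) (𝓝[>] 0)
      (𝓝 (graphPoint e γ 0 y)) := by
    simpa using (hc.tendsto 0).mono_left nhdsWithin_le_nhds
  by_cases hx : graphPoint e γ 0 y ∈ tsupport G
  · have hU := hGU hx
    have hcl := h.graphPoint_mem_closure le_rfl hU
    refine (hG _ hcl).tendsto.comp (tendsto_nhdsWithin_iff.mpr ⟨ht, ?_⟩)
    filter_upwards [ht.eventually (h.isOpen.mem_nhds hU), self_mem_nhdsWithin] with ε h1 h2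
    exact h.graphPoint_mem_closure (mul_pos h2 hσ).le h1
  · have hev := notMem_tsupport_iff_eventuallyEq.mp hx
    rw [hev.eq_of_nhds]
    refine tendsto_const_nhds.congr' ?_
    filter_upwards [ht.eventually hev] with ε h1 using h1.symm

theorem tendsto_integral_layer (h : IsGraphChart Ω U e K γ) (hb : Bornology.IsBounded Ω)
    (hG : ContinuousOn G (closure Ω)) (hGc : HasCompactSupport G) (hGU : tsupport G ⊆ U) :
    Filter.Tendsto (fun ε => ∫ p : Horizontal e × ℝ, (Ioo 1 2).indicator (fun _ =>
        fderiv ℝ (depth e γ) (graphPoint e γ 0 p.1) (G (graphPoint e γ (ε * p.2) p.1))) p.2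
          ∂(volume.prod volume)) (𝓝[>] 0)
      (𝓝 (∫ y : Horizontal e,
        fderiv ℝ (depth e γ) (graphPoint e γ 0 y) (G (graphPoint e γ 0 y)))) := by
  obtain ⟨B, hB0, hB⟩ := h.exists_norm_fderiv_depth_apply_le hb hG
  set T := (Submodule.span ℝ {e})ᗮ.orthogonalProjectionOnto '' tsupport G with hT
  have hTc : IsCompact T := isCompact_projection_tsupport hGc
  -- The rescaled layer `(1, 2)` has length 1, so a limit independent of `σ` integrates to the
  -- boundary integral itself.
  have hlim : ∫ y : Horizontal e,
        fderiv ℝ (depth e γ) (graphPoint e γ 0 y) (G (graphPoint e γ 0 y)) =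
      ∫ p : Horizontal e × ℝ, (Ioo 1 2).indicator (fun _ =>
        fderiv ℝ (depth e γ) (graphPoint e γ 0 p.1) (G (graphPoint e γ 0 p.1))) p.2
          ∂(volume.prod volume) := by
    have h1 := integral_prod_mul (μ := volume) (ν := volume) (fun y : Horizontal e =>
      fderiv ℝ (depth e γ) (graphPoint e γ 0 y) (G (graphPoint e γ 0 y)))
      ((Ioo (1 : ℝ) 2).indicator fun _ => (1 : ℝ))
    have h2 : ∫ σ : ℝ, (Ioo (1 : ℝ) 2).indicator (fun _ => (1 : ℝ)) σ = 1 := by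
      rw [integral_indicator measurableSet_Ioo]
      norm_num
    rw [h2, mul_one] at h1
    rw [← h1]
    refine integral_congr_ae (ae_of_all _ fun p => ?_)
    by_cases hp : p.2 ∈ Ioo (1 : ℝ) 2
    · simp only [indicator_of_mem hp, mul_one]
    · simp only [indicator_of_notMem hp, mul_zero]
  rw [hlim]
  have hmeas : ∀ ε : ℝ, 0 < ε → ∀ p : Horizontal e × ℝ, (Ioo 1 2).indicator (fun _ =>
        fderiv ℝ (depth e γ) (graphPoint e γ 0 p.1) (G (graphPoint e γ (ε * p.2) p.1))) p.2 =
      (Prod.snd ⁻¹' Ioo 1 2).indicator (fun p : Horizontal e × ℝ =>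
        fderiv ℝ (depth e γ) (graphPoint e γ 0 p.1)
          ((closure Ω).indicator G (graphPoint e γ (ε * p.2) p.1))) p := by
    intro ε hε p
    by_cases hp : p.2 ∈ Ioo (1 : ℝ) 2
    · rw [indicator_of_mem hp, indicator_of_mem (show p ∈ Prod.snd ⁻¹' Ioo 1 2 from hp),
        h.indicator_closure_graphPoint hGU (mul_pos hε (zero_lt_one.trans hp.1)).le]
    · rw [indicator_of_notMem hp, indicator_of_notMem (show p ∉ Prod.snd ⁻¹' Ioo 1 2 from hp)]
  refine tendsto_integral_filter_of_dominated_convergence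
    ((T ×ˢ Ioo (1 : ℝ) 2).indicator fun _ => B) ?_ ?_ ?_ (ae_of_all _ fun p => ?_)
  · filter_upwards [self_mem_nhdsWithin] with ε hε
    simp_rw [hmeas ε hε]
    have hc : Continuous fun p : Horizontal e × ℝ => graphPoint e γ (ε * p.2) p.1 :=
      (continuous_graphPoint h.lipschitz.continuous).comp
        (continuous_fst.prodMk (continuous_const.mul continuous_snd))
    exact (aestronglyMeasurable_fderiv_depth_apply h.lipschitz.continuous measurable_fst
      ((measurable_indicator_closure hG).comp hc.measurable)).indicator
        (measurable_snd measurableSet_Ioo)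
  · filter_upwards [self_mem_nhdsWithin] with ε hε
    refine ae_of_all _ fun p => ?_
    by_cases hp2 : p.2 ∈ Ioo (1 : ℝ) 2
    · by_cases hp1 : p.1 ∈ T
      · rw [indicator_of_mem (mk_mem_prod hp1 hp2 : p ∈ T ×ˢ Ioo (1 : ℝ) 2), hmeas ε hε,
          indicator_of_mem (show p ∈ Prod.snd ⁻¹' Ioo 1 2 from hp2)]
        exact hB _ _
      · have hy' : graphPoint e γ (ε * p.2) p.1 ∉ tsupport G := fun hx => hp1
          ⟨_, hx, orthogonalProjectionOnto_graphPoint h.norm_eq_one _ _⟩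
        rw [indicator_of_mem hp2, image_eq_zero_of_notMem_tsupport hy', map_zero, norm_zero]
        exact indicator_nonneg (fun _ _ => hB0) _
    · rw [indicator_of_notMem hp2, norm_zero]
      exact indicator_nonneg (fun _ _ => hB0) _
  · refine (integrable_indicator_iff (hTc.measurableSet.prod measurableSet_Ioo)).mpr
      (integrableOn_const ?_)
    rw [Measure.prod_prod]
    exact ENNReal.mul_ne_top hTc.measure_lt_top.ne measure_Ioo_lt_top.ne
  · by_cases hp : p.2 ∈ Ioo (1 : ℝ) 2
    · simp only [indicator_of_mem hp]
      exact ((fderiv ℝ (depth e γ) _).continuous.tendsto _).comp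
        (h.tendsto_graphPoint hG hGU p.1 (zero_lt_one.trans hp.1))
    · simp only [indicator_of_notMem hp]
      exact tendsto_const_nhds

/-- The divergence theorem in graph coordinates. -/
theorem integral_divergence_eq_neg_integral (h : IsGraphChart Ω U e K γ) (hΩ : IsOpen Ω)
    (hb : Bornology.IsBounded Ω) (hG : IsC1UpToBoundary Ω G) (hGc : HasCompactSupport G)
    (hGU : tsupport G ⊆ U) :
    ∫ x in Ω, divergence G x = -∫ y : Horizontal e,
      fderiv ℝ (depth e γ) (graphPoint e γ 0 y) (G (graphPoint e γ 0 y)) := by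
  have h1 := h.tendsto_integral_depthCutoff_mul hΩ (hG.integrableOn_divergence hΩ hb) hGU
  have h2 := (h.tendsto_integral_layer hb hG.1 hGc hGU).neg
  refine tendsto_nhds_unique h1 (h2.congr' ?_)
  filter_upwards [self_mem_nhdsWithin] with ε hε
  have hε : 0 < ε := hε
  obtain ⟨C, hC⟩ := exists_lipschitzWith_depthCutoff h.norm_eq_one h.lipschitz ε
  rw [integral_mul_divergence_eq_neg hΩ hC (hG.contDiffOn hΩ) hGc ?_]
  · congr 1
    have h3 : ∫ x, fderiv ℝ (depthCutoff e γ ε) x (G x) = ε⁻¹ * ∫ x,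
        (Ioo 1 2).indicator (fun _ => fderiv ℝ (depth e γ) x (G x)) (ε⁻¹ * depth e γ x) := by
      rw [← integral_const_mul]
      refine integral_congr_ae ?_
      filter_upwards [ae_fderiv_depthCutoff h.norm_eq_one h.lipschitz hε] with x hx using hx _
    -- The slope `ε⁻¹` of the cutoff is absorbed exactly by the rescaling of the depth to `εσ`.
    rw [h3, ← integral_graphPoint_mul h.norm_eq_one h.lipschitz.continuous hε]
    refine integral_congr_ae (ae_of_all _ fun p => ?_)
    simp only [depth_graphPoint h.norm_eq_one, inv_mul_cancel_left₀ hε.ne',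
      fderiv_depth_graphPoint h.norm_eq_one (ε * p.2) p.1]
  · rintro x ⟨hx1, hx2⟩
    exact (h.mem_iff x (hGU hx2)).mpr
      (hε.trans_le (tsupport_depthCutoff_subset h.norm_eq_one h.lipschitz hε hx1))

/-! ### Boundary integrals in a chart -/

/-- At a boundary point over a point of differentiability, the outward normal is the normalised
negative gradient of the depth. -/
theorem isOutwardUnitNormal_graphPoint (h : IsGraphChart Ω U e K γ) {y : Horizontal e}
    (hy : DifferentiableAt ℝ (fun z : Horizontal e => γ z) y) (hyU : graphPoint e γ 0 y ∈ U) :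
    ∃ n, IsOutwardUnitNormal Ω (graphPoint e γ 0 y) n ∧ ∀ w,
      graphDensity e γ y * inner ℝ w n = -fderiv ℝ (depth e γ) (graphPoint e γ 0 y) w := by
  have hd := hasFDerivAt_depth hy h.norm_eq_one
  set N := e - ((InnerProductSpace.toDual ℝ (Horizontal e)).symm
      (fderiv ℝ (fun z : Horizontal e => γ z) y) : Space d) with hN
  have hNe : inner ℝ N e = 1 := by
    rw [hN, inner_sub_left, inner_horizontal_right, real_inner_self_eq_norm_sq, h.norm_eq_one]
    norm_num
  have hN0 : N ≠ 0 := by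
    intro h0
    rw [h0, inner_zero_left] at hNe
    exact zero_ne_one hNe
  refine ⟨‖N‖⁻¹ • N, isOutwardUnitNormal_of_hasFDerivAt (h.isOpen.mem_nhds hyU) h.mem_iff
    (depth_graphPoint h.norm_eq_one _ _) hd hN0, fun w => ?_⟩
  have hJ : graphDensity e γ y = ‖N‖ := by
    rw [graphDensity, hd.fderiv, norm_neg, innerSL_apply_norm]
  have : ‖N‖ ≠ 0 := norm_ne_zero_iff.mpr hN0
  rw [hJ, hd.fderiv, real_inner_smul_right, mul_inv_cancel_left₀ this]
  simp [real_inner_comm]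

theorem frontier_inter_eq (h : IsGraphChart Ω U e K γ) (hΩ : IsOpen Ω) :
    frontier Ω ∩ U = range (graphPoint e γ 0) ∩ U := by
  ext x
  refine and_congr_left fun hx => ?_
  rw [h.mem_frontier_iff hΩ hx]
  constructor
  · intro h0
    refine ⟨(Submodule.span ℝ {e})ᗮ.orthogonalProjectionOnto x, ?_⟩
    rw [← h0, graphPoint_depth h.norm_eq_one]
  · rintro ⟨y, rfl⟩
    exact depth_graphPoint h.norm_eq_one _ _

/-- In a chart, the surface measure is the image of a weighted horizontal measure. -/
theorem surfaceMeasure_restrict (h : IsGraphChart Ω U e K γ) (hΩ : IsOpen Ω) :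
    (surfaceMeasure Ω).restrict U = (Measure.map (graphPoint e γ 0)
      (volume.withDensity fun y => ENNReal.ofReal (graphDensity e γ y))).restrict U := by
  rw [map_graphPoint_withDensity h.norm_eq_one h.lipschitz, surfaceMeasure,
    Measure.restrict_restrict h.isOpen.measurableSet,
    Measure.restrict_restrict h.isOpen.measurableSet, inter_comm, h.frontier_inter_eq hΩ,
    inter_comm]

theorem measurableEmbedding_graphPoint_zero (h : IsGraphChart Ω U e K γ) :
    MeasurableEmbedding (graphPoint e γ 0) :=
  ((continuous_graphPoint h.lipschitz.continuous).comp
    (continuous_id.prodMk continuous_const)).measurableEmbedding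
      (graphPoint_injective h.norm_eq_one 0)

/-- The outward normal exists almost everywhere on the boundary inside a chart. -/
theorem ae_isOutwardUnitNormal (h : IsGraphChart Ω U e K γ) (hΩ : IsOpen Ω) :
    ∀ᵐ x ∂((surfaceMeasure Ω).restrict U), ∃ n, IsOutwardUnitNormal Ω x n := by
  rw [h.surfaceMeasure_restrict hΩ, ae_restrict_iff' h.isOpen.measurableSet,
    h.measurableEmbedding_graphPoint_zero.ae_map_iff]
  refine (withDensity_absolutelyContinuous _ _).ae_le ?_
  filter_upwards [ae_differentiableAt_horizontal h.lipschitz] with y hy hyU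
  exact (h.isOutwardUnitNormal_graphPoint hy hyU).imp fun n hn => hn.1

/-- The divergence theorem for fields supported in a boundary chart. -/
theorem integral_divergence (h : IsGraphChart Ω U e K γ) (hΩ : IsOpen Ω)
    (hb : Bornology.IsBounded Ω) (hG : IsC1UpToBoundary Ω G) (hGc : HasCompactSupport G)
    (hGU : tsupport G ⊆ U) :
    Integrable (fun x => inner ℝ (G x) (outwardNormal Ω x)) (surfaceMeasure Ω) ∧
      ∫ x in Ω, divergence G x =
        ∫ x, inner ℝ (G x) (outwardNormal Ω x) ∂(surfaceMeasure Ω) := by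
  set q : Space d → ℝ := fun x => inner ℝ (G x) (outwardNormal Ω x) with hq
  have hq0 : ∀ x ∉ U, q x = 0 := fun x hx => by
    rw [hq]
    simp [image_eq_zero_of_notMem_tsupport fun hx' => hx (hGU hx')]
  have hJm : Measurable fun y : Horizontal e => ENNReal.ofReal (graphDensity e γ y) :=
    (measurable_graphDensity h.lipschitz.continuous).ennreal_ofReal
  have hJt : ∀ᵐ y : Horizontal e, ENNReal.ofReal (graphDensity e γ y) < ⊤ :=
    ae_of_all _ fun _ => ENNReal.ofReal_lt_top
  have hemb := h.measurableEmbedding_graphPoint_zero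
  -- The density is the length of the gradient of the depth, so multiplying the unit normal by it
  -- gives back the unnormalised negative gradient.
  have hae : (fun y : Horizontal e => (ENNReal.ofReal (graphDensity e γ y)).toReal •
      q (graphPoint e γ 0 y)) =ᵐ[volume] fun y =>
        -fderiv ℝ (depth e γ) (graphPoint e γ 0 y) (G (graphPoint e γ 0 y)) := by
    filter_upwards [ae_differentiableAt_horizontal h.lipschitz] with y hy
    rw [ENNReal.toReal_ofReal (show 0 ≤ graphDensity e γ y from norm_nonneg _), smul_eq_mul]
    by_cases hyU : graphPoint e γ 0 y ∈ U
    · obtain ⟨n, hn, hn'⟩ := h.isOutwardUnitNormal_graphPoint hy hyU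
      rw [hq]
      simp only [outwardNormal_eq hn]
      exact hn' _
    · rw [hq0 _ hyU, image_eq_zero_of_notMem_tsupport fun hx' => hyU (hGU hx')]
      simp
  have hint := h.integrable_fderiv_depth_graphPoint hb hG.1 hGc hGU
  have hmap : Integrable q (Measure.map (graphPoint e γ 0)
      (volume.withDensity fun y => ENNReal.ofReal (graphDensity e γ y))) := by
    rw [hemb.integrable_map_iff, integrable_withDensity_iff_integrable_smul' hJm hJt]
    exact hint.neg.congr hae.symm
  constructor
  · refine (integrableOn_iff_integrable_of_support_subset (s := U) fun x hx => ?_).mp ?_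
    · exact not_not.mp fun hxU => hx (hq0 x hxU)
    · rw [IntegrableOn, h.surfaceMeasure_restrict hΩ]
      exact hmap.integrableOn
  · rw [h.integral_divergence_eq_neg_integral hΩ hb hG hGc hGU,
      ← setIntegral_eq_integral_of_forall_compl_eq_zero hq0, h.surfaceMeasure_restrict hΩ,
      setIntegral_eq_integral_of_forall_compl_eq_zero hq0, hemb.integral_map,
      integral_withDensity_eq_integral_toReal_smul hJm hJt, ← integral_neg]
    exact integral_congr_ae hae.symm

end IsGraphChart


/-! ### The divergence theorem on Lipschitz domains -/

section Gauss

variable {Ω : Set (Space d)}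

theorem IsC1UpToBoundary.smul {g : Space d → ℝ} {G : Space d → Space d}
    {Dg : Space d → Space d →L[ℝ] ℝ} (hg : ContinuousOn g (closure Ω))
    (hDg : ContinuousOn Dg (closure Ω)) (hgD : ∀ x ∈ Ω, HasFDerivAt g (Dg x) x)
    (hG : IsC1UpToBoundary Ω G) : IsC1UpToBoundary Ω fun x => g x • G x := by
  obtain ⟨hGc, D, hD, hGD⟩ := hG
  refine ⟨hg.smul hGc, fun x => g x • D x + (Dg x).smulRight (G x), ?_, fun x hx =>
    (hgD x hx).smul (hGD x hx)⟩
  refine (hg.smul hD).add ?_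
  have := (ContinuousLinearMap.smulRightL ℝ (Space d) (Space d)).continuous₂.comp_continuousOn
    (hDg.prodMk hGc)
  exact this

theorem IsC1UpToBoundary.contDiff_smul {φ : Space d → ℝ} (hφ : ContDiff ℝ 1 φ)
    {G : Space d → Space d} (hG : IsC1UpToBoundary Ω G) :
    IsC1UpToBoundary Ω fun x => φ x • G x :=
  hG.smul hφ.continuous.continuousOn (hφ.continuous_fderiv one_ne_zero).continuousOn
    fun x _ => (hφ.differentiable one_ne_zero x).hasFDerivAt

theorem divergence_sum {ι : Type*} [Fintype ι] {G : ι → Space d → Space d} {x : Space d}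
    (h : ∀ i, DifferentiableAt ℝ (G i) x) :
    divergence (fun y => ∑ i, G i y) x = ∑ i, divergence (G i) x := by
  rw [divergence_eq_of_hasFDerivAt (HasFDerivAt.fun_sum fun i _ => (h i).hasFDerivAt)]
  simp_rw [divergence_eq_of_hasFDerivAt (h _).hasFDerivAt]
  rw [Finset.sum_comm]
  simp

theorem setIntegral_divergence_eq_zero (hΩ : IsOpen Ω) {G : Space d → Space d}
    (hG : ContDiffOn ℝ 1 G Ω) (hGc : HasCompactSupport G) (hsupp : tsupport G ⊆ Ω) :
    ∫ x in Ω, divergence G x = 0 := by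
  rw [setIntegral_eq_integral_of_forall_compl_eq_zero fun x hx =>
    divergence_eq_zero_of_notMem_tsupport fun hx' => hx (hsupp hx')]
  exact integral_divergence_eq_zero hΩ hG hGc hsupp

/-- At an interior point `Ω` itself serves: a field with compact support in `Ω` has zero total
divergence and vanishes on the boundary. At a boundary point a graph chart serves. -/
theorem exists_nhds_integral_divergence (hΩ : IsOpen Ω) (hb : Bornology.IsBounded Ω)
    (hLip : HasLipschitzBoundary Ω) {p : Space d} (hp : p ∈ closure Ω) :
    ∃ U : Set (Space d), IsOpen U ∧ p ∈ U ∧ ∀ G, IsC1UpToBoundary Ω G → HasCompactSupport G →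
      tsupport G ⊆ U →
        Integrable (fun x => inner ℝ (G x) (outwardNormal Ω x)) (surfaceMeasure Ω) ∧
        ∫ x in Ω, divergence G x =
          ∫ x, inner ℝ (G x) (outwardNormal Ω x) ∂(surfaceMeasure Ω) := by
  by_cases hpΩ : p ∈ Ω
  · refine ⟨Ω, hΩ, hpΩ, fun G hG hGc hGU => ?_⟩
    have hae : (fun x => inner ℝ (G x) (outwardNormal Ω x)) =ᵐ[surfaceMeasure Ω] 0 := by
      rw [surfaceMeasure]
      filter_upwards [ae_restrict_mem isClosed_frontier.measurableSet] with x hx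
      rw [hΩ.frontier_eq] at hx
      simp [image_eq_zero_of_notMem_tsupport fun hx' => hx.2 (hGU hx')]
    refine ⟨(integrable_zero _ _ _).congr hae.symm, ?_⟩
    rw [integral_congr_ae hae, setIntegral_divergence_eq_zero hΩ (hG.contDiffOn hΩ) hGc hGU]
    simp
  · obtain ⟨U, e, K, γ, hpU, h⟩ := hLip.exists_isGraphChart
      (hΩ.frontier_eq ▸ ⟨hp, hpΩ⟩ : p ∈ frontier Ω)
    exact ⟨U, h.isOpen, hpU, fun G hG hGc hGU => h.integral_divergence hΩ hb hG hGc hGU⟩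

/-- A compact set has a finite smooth partition of unity subordinate to given neighbourhoods, with
compactly supported members. -/
theorem exists_finite_partition_of_unity {S : Set (Space d)} (hS : IsCompact S)
    {U : Space d → Set (Space d)} (hU : ∀ p ∈ S, IsOpen (U p) ∧ p ∈ U p) :
    ∃ (t : Finset (Space d)) (φ : t → Space d → ℝ), (∀ i : t, (i : Space d) ∈ S) ∧
      (∀ i, ContDiff ℝ 1 (φ i)) ∧ (∀ i, HasCompactSupport (φ i)) ∧
      (∀ i : t, tsupport (φ i) ⊆ U i) ∧ ∀ x ∈ S, ∑ i, φ i x = 1 := by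
  -- Intersecting with unit balls makes the members of the partition compactly supported.
  obtain ⟨t, htS, ht⟩ := hS.elim_nhds_subcover (fun p => U p ∩ Metric.ball p 1) fun p hp =>
    ((hU p hp).1.inter Metric.isOpen_ball).mem_nhds ⟨(hU p hp).2, Metric.mem_ball_self one_pos⟩
  obtain ⟨f, hf⟩ := SmoothPartitionOfUnity.exists_isSubordinate
    (modelWithCornersSelf ℝ (Space d)) hS.isClosed
    (fun i : t => U i ∩ Metric.ball (i : Space d) 1)
    (fun i => (hU i (htS _ i.2)).1.inter Metric.isOpen_ball)
    (ht.trans (iUnion₂_subset fun p hp => subset_iUnion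
      (fun i : t => U i ∩ Metric.ball (i : Space d) 1) ⟨p, hp⟩))
  refine ⟨t, fun i => f i, fun i => htS _ i.2, fun i => ?_, fun i => ?_, fun i => ?_,
    fun x hx => ?_⟩
  · exact (f i).contMDiff.contDiff.of_le (by norm_cast)
  · exact (isCompact_closedBall (i : Space d) 1).of_isClosed_subset (isClosed_tsupport _)
      ((hf i).trans (inter_subset_right.trans Metric.ball_subset_closedBall))
  · exact (hf i).trans inter_subset_left
  · rw [← f.sum_eq_one hx, finsum_eq_sum_of_fintype]

/-- **Divergence theorem** on a bounded open set with Lipschitz boundary. -/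
theorem integral_divergence_eq_boundary (hΩ : IsOpen Ω) (hb : Bornology.IsBounded Ω)
    (hLip : HasLipschitzBoundary Ω) {F : Space d → Space d} (hF : IsC1UpToBoundary Ω F) :
    Integrable (fun x => inner ℝ (F x) (outwardNormal Ω x)) (surfaceMeasure Ω) ∧
      ∫ x in Ω, divergence F x =
        ∫ x, inner ℝ (F x) (outwardNormal Ω x) ∂(surfaceMeasure Ω) := by
  choose! U hUo hpU hU using fun p (hp : p ∈ closure Ω) =>
    exists_nhds_integral_divergence hΩ hb hLip hp
  obtain ⟨t, φ, htS, hφ, hφc, hφU, hφ1⟩ := exists_finite_partition_of_unity hb.isCompact_closure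
    fun p hp => ⟨hUo p hp, hpU p hp⟩
  have hG : ∀ i, IsC1UpToBoundary Ω fun x => φ i x • F x := fun i => hF.contDiff_smul (hφ i)
  have hloc := fun i : t => hU i (htS i) (fun x => φ i x • F x) (hG i) ((hφc i).smul_right)
    ((tsupport_smul_subset_left (φ i) F).trans (hφU i))
  have hsum : ∀ x ∈ closure Ω, ∑ i, φ i x • F x = F x := fun x hx => by
    rw [← Finset.sum_smul, hφ1 x hx, one_smul]
  have hbd : (fun x => inner ℝ (F x) (outwardNormal Ω x)) =ᵐ[surfaceMeasure Ω]
      fun x => ∑ i, inner ℝ (φ i x • F x) (outwardNormal Ω x) := by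
    rw [surfaceMeasure]
    filter_upwards [ae_restrict_mem isClosed_frontier.measurableSet] with x hx
    rw [← sum_inner, hsum x (frontier_subset_closure hx)]
  refine ⟨(integrable_finsetSum _ fun i _ => (hloc i).1).congr hbd.symm, ?_⟩
  rw [integral_congr_ae hbd, integral_finsetSum _ fun i _ => (hloc i).1]
  rw [← Finset.sum_congr rfl fun i _ => (hloc i).2,
    ← integral_finsetSum _ fun i _ => (hG i).integrableOn_divergence hΩ hb]
  refine setIntegral_congr_fun hΩ.measurableSet fun x hx => ?_
  obtain ⟨-, D, -, hD⟩ := id hF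
  rw [← divergence_sum (G := fun i y => φ i y • F y) fun i => (((hφ i).differentiable one_ne_zero) x).smul
    (hD x hx).differentiableAt]
  -- The partition sums to 1 only on `closure Ω`, but this contains a neighbourhood of the point `x`
  -- of the open set `Ω`, so derivatives agree.
  refine divergence_congr ?_
  filter_upwards [hΩ.mem_nhds hx] with y hy
  exact (hsum y (subset_closure hy)).symm

/-- The outward unit normal exists almost everywhere on a Lipschitz boundary. -/
theorem ae_isOutwardUnitNormal_outwardNormal (hΩ : IsOpen Ω) (hLip : HasLipschitzBoundary Ω) :
    ∀ᵐ x ∂(surfaceMeasure Ω), IsOutwardUnitNormal Ω x (outwardNormal Ω x) := by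
  suffices h : ∀ᵐ x ∂(surfaceMeasure Ω), ∃ n, IsOutwardUnitNormal Ω x n by
    filter_upwards [h] with x ⟨n, hn⟩
    rwa [outwardNormal_eq hn]
  rw [surfaceMeasure, ae_restrict_iff' isClosed_frontier.measurableSet, ae_iff]
  -- Nullness is local, so Rademacher's theorem in each chart is enough.
  refine measure_null_of_locally_null _ fun p hp => ?_
  obtain ⟨hp, -⟩ := Classical.not_imp.mp hp
  obtain ⟨U, e, K, γ, hpU, h⟩ := hLip.exists_isGraphChart hp
  have := h.ae_isOutwardUnitNormal hΩ
  rw [surfaceMeasure, Measure.restrict_restrict h.isOpen.measurableSet,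
    ae_restrict_iff' (h.isOpen.measurableSet.inter isClosed_frontier.measurableSet)] at this
  refine ⟨_, inter_mem_nhdsWithin _ (h.isOpen.mem_nhds hpU), measure_mono_null ?_ this⟩
  rintro x ⟨hx, hxU⟩ hx'
  exact hx fun hxf => hx' ⟨hxU, hxf⟩

end Gauss

/-! ### Product rules -/

section ProductRules

variable {x : Space d} {a u v : Space d → Space d}

theorem convectiveForm_eq (a u : Space d → Space d) (x : Space d) :
    convectiveForm a u x = fderiv ℝ u x (a x) := by
  conv_rhs => rw [← (EuclideanSpace.basisFun (Fin d) ℝ).sum_repr (a x)]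
  simp [convectiveForm, partialDeriv]

theorem divergence_smul {g : Space d → ℝ} (hg : DifferentiableAt ℝ g x)
    (ha : DifferentiableAt ℝ a x) :
    divergence (fun y => g y • a y) x = fderiv ℝ g x (a x) + g x * divergence a x := by
  rw [divergence_eq_of_hasFDerivAt (hg.hasFDerivAt.fun_smul ha.hasFDerivAt),
    divergence_eq_of_hasFDerivAt ha.hasFDerivAt, ← sum_coord_mul_apply_single, Finset.mul_sum,
    ← Finset.sum_add_distrib]
  refine Finset.sum_congr rfl fun j _ => ?_
  simp [add_comm]

theorem inner_advection_sub (s : ℝ) (ha : DifferentiableAt ℝ a x) (hu : DifferentiableAt ℝ u x)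
    (hv : DifferentiableAt ℝ v x) :
    inner ℝ (v x) (advection s a u x) - inner ℝ ((-advection (1 - s) a v) x) (u x) =
      divergence (fun y => (inner ℝ (v y) (u y) : ℝ) • a y) x := by
  rw [divergence_smul (hv.inner ℝ hu) ha, (hv.hasFDerivAt.inner ℝ hu.hasFDerivAt).fderiv]
  simp only [Pi.neg_apply, advection, convectiveForm_eq, inner_add_right, inner_neg_left,
    inner_add_left, real_inner_smul_left, real_inner_smul_right, ContinuousLinearMap.comp_apply,
    ContinuousLinearMap.prod_apply, fderivInnerCLM_apply]
  ring

theorem divergenceForm_eq_advection (ha : DifferentiableAt ℝ a x) (hu : DifferentiableAt ℝ u x) :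
    divergenceForm a u x = advection 1 a u x := by
  ext i
  have hj : ∀ j, partialDeriv j (fun y => outer u a y i j) x =
      fderiv ℝ u x (EuclideanSpace.single j 1) i * a x j +
        u x i * fderiv ℝ a x (EuclideanSpace.single j 1) j := fun j => by
    have h1 : DifferentiableAt ℝ (fun y => u y i) x := by fun_prop
    have h2 : DifferentiableAt ℝ (fun y => a y j) x := by fun_prop
    have e1 := partialDeriv_coord hu.hasFDerivAt i j
    have e2 := partialDeriv_coord ha.hasFDerivAt j j
    rw [partialDeriv] at e1 e2
    rw [partialDeriv, show (fun y => outer u a y i j) = fun y => u y i * a y j from rfl,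
      fderiv_fun_mul h1 h2, ← e1, ← e2]
    simp
    ring
  have hsum := sum_coord_mul_apply_single
    ((EuclideanSpace.proj i : Space d →L[ℝ] ℝ).comp (fderiv ℝ u x)) (a x)
  simp only [ContinuousLinearMap.comp_apply, PiLp.proj_apply] at hsum
  rw [divergenceForm, tensorDivergence, advection, convectiveForm_eq]
  simp only [hj, Finset.sum_add_distrib, hsum, PiLp.add_apply, PiLp.smul_apply, one_mul,
    smul_eq_mul, divergence_eq_of_hasFDerivAt ha.hasFDerivAt, Finset.sum_mul, Finset.mul_sum]
  congr 1
  exact Finset.sum_congr rfl fun j _ => mul_comm _ _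

/-- The contraction is `(a·n̂) u`, so the boundary integrand is the normal flux of `(v·u) a`, the
field to which the divergence theorem is applied. -/
theorem boundaryFlux_eq (Ω : Set (Space d)) (a u v : Space d → Space d) (x : Space d) :
    boundaryFlux Ω a u v x =
      inner ℝ ((inner ℝ (v x) (u x) : ℝ) • a x) (outwardNormal Ω x) := by
  have h : normalContraction (outwardNormal Ω x) (outer u a x) =
      (inner ℝ (a x) (outwardNormal Ω x) : ℝ) • u x := by
    ext i
    simp only [normalContraction, outer, Matrix.of_apply, PiLp.smul_apply, smul_eq_mul,
      PiLp.inner_apply, RCLike.inner_apply, conj_trivial, Finset.sum_mul]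
    exact Finset.sum_congr rfl fun j _ => by ring
  rw [boundaryFlux, h, real_inner_smul_right, real_inner_smul_left, mul_comm]

end ProductRules


/-! ### The exact adjoint relation -/

section AdjointRelation

variable {Ω : Set (Space d)} {a u v : Space d → Space d}

theorem IsC1UpToBoundary.inner_smul (hu : IsC1UpToBoundary Ω u) (hv : IsC1UpToBoundary Ω v)
    (ha : IsC1UpToBoundary Ω a) :
    IsC1UpToBoundary Ω fun x => (inner ℝ (v x) (u x) : ℝ) • a x := by
  obtain ⟨huc, Du, hDu, huD⟩ := hu
  obtain ⟨hvc, Dv, hDv, hvD⟩ := hv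
  refine ha.smul (Dg := fun x => (innerSL ℝ (v x)).comp (Du x) + (innerSL ℝ (u x)).comp (Dv x))
    (hvc.inner huc) ?_ fun x hx => ?_
  · exact (((innerSL ℝ).continuous.comp_continuousOn hvc).clm_comp hDu).add
      (((innerSL ℝ).continuous.comp_continuousOn huc).clm_comp hDv)
  · refine ((hvD x hx).inner ℝ (huD x hx)).congr_fderiv ?_
    ext w
    simp [real_inner_comm]

theorem IsC1UpToBoundary.integrableOn_inner_advection (hΩ : IsOpen Ω)
    (hb : Bornology.IsBounded Ω) (ha : IsC1UpToBoundary Ω a) (hu : IsC1UpToBoundary Ω u)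
    (hv : ContinuousOn v (closure Ω)) (s : ℝ) :
    IntegrableOn (fun x => (inner ℝ (v x) (advection s a u x) : ℝ)) Ω := by
  obtain ⟨hac, Da, hDa, haD⟩ := ha
  obtain ⟨huc, Du, hDu, huD⟩ := hu
  refine integrableOn_of_continuousOn_closure hΩ hb
    (f := fun x => inner ℝ (v x) (Du x (a x) +
      (s * ∑ j, Da x (EuclideanSpace.single j 1) j) • u x)) ?_ fun x hx => ?_
  · have h1 : ContinuousOn (fun x => s * ∑ j, Da x (EuclideanSpace.single j 1) j) (closure Ω) :=
      continuousOn_const.mul (continuousOn_sum_apply_single hDa)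
    exact hv.inner ((hDu.clm_apply hac).add (h1.smul huc))
  · simp only [advection, convectiveForm_eq, (huD x hx).fderiv,
      divergence_eq_of_hasFDerivAt (haD x hx)]

theorem advection_adjoint_relation (hΩ : IsOpen Ω) (hb : Bornology.IsBounded Ω)
    (hLip : HasLipschitzBoundary Ω) (ha : IsC1UpToBoundary Ω a) (hu : IsC1UpToBoundary Ω u)
    (hv : IsC1UpToBoundary Ω v) (s : ℝ) :
    PairingIntegrable Ω v (advection s a u) ∧
      PairingIntegrable Ω (-advection (1 - s) a v) u ∧
      Integrable (boundaryFlux Ω a u v) (surfaceMeasure Ω) ∧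
      innerOn Ω v (advection s a u) = innerOn Ω (-advection (1 - s) a v) u +
        ∫ x, boundaryFlux Ω a u v x ∂(surfaceMeasure Ω) := by
  have h1 : PairingIntegrable Ω v (advection s a u) :=
    ha.integrableOn_inner_advection hΩ hb hu hv.1 s
  have h2 : PairingIntegrable Ω (-advection (1 - s) a v) u := by
    have := (ha.integrableOn_inner_advection hΩ hb hv hu.1 (1 - s)).neg
    refine this.congr (ae_of_all _ fun x => ?_)
    simp [real_inner_comm]
  obtain ⟨h3, h4⟩ := integral_divergence_eq_boundary hΩ hb hLip (hu.inner_smul hv ha)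
  have hflux : boundaryFlux Ω a u v = fun x =>
      inner ℝ ((inner ℝ (v x) (u x) : ℝ) • a x) (outwardNormal Ω x) :=
    funext fun x => boundaryFlux_eq Ω a u v x
  refine ⟨h1, h2, hflux ▸ h3, ?_⟩
  rw [hflux, ← h4, ← sub_eq_iff_eq_add', innerOn, innerOn, ← integral_sub h1 h2]
  obtain ⟨-, Da, -, haD⟩ := ha
  obtain ⟨-, Du, -, huD⟩ := hu
  obtain ⟨-, Dv, -, hvD⟩ := hv
  exact setIntegral_congr_fun hΩ.measurableSet fun x hx => inner_advection_sub s
    (haD x hx).differentiableAt (huD x hx).differentiableAt (hvD x hx).differentiableAt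

end AdjointRelation

/-! ### Formal adjoints -/

section FormalAdjoint

variable {Ω : Set (Space d)} {a u v : Space d → Space d}

theorem continuousOn_advection (hΩ : IsOpen Ω) (ha : ContDiffOn ℝ 1 a Ω)
    (hu : ContDiffOn ℝ 1 u Ω) (s : ℝ) : ContinuousOn (advection s a u) Ω := by
  have hDa := ha.continuousOn_fderiv_of_isOpen hΩ le_rfl
  have hDu := hu.continuousOn_fderiv_of_isOpen hΩ le_rfl
  have h : ContinuousOn (fun x => fderiv ℝ u x (a x) +
      (s * ∑ j, fderiv ℝ a x (EuclideanSpace.single j 1) j) • u x) Ω := by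
    have h1 : ContinuousOn (fun x => s * ∑ j, fderiv ℝ a x (EuclideanSpace.single j 1) j) Ω :=
      continuousOn_const.mul (continuousOn_sum_apply_single hDa)
    exact (hDu.clm_apply ha.continuousOn).add (h1.smul hu.continuousOn)
  refine h.congr fun x hx => ?_
  rw [advection, convectiveForm_eq, divergence_eq_of_hasFDerivAt
    ((ha.contDiffAt (hΩ.mem_nhds hx)).differentiableAt one_ne_zero).hasFDerivAt]

theorem advection_eq_zero_of_notMem_tsupport {s : ℝ} {x : Space d} (hx : x ∉ tsupport v) :
    advection s a v x = 0 := by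
  have h := notMem_tsupport_iff_eventuallyEq.mp hx
  rw [advection, convectiveForm_eq, h.fderiv_eq, h.eq_of_nhds]
  simp

theorem integrableOn_of_continuousOn_of_eq_zero {E : Type*} [NormedAddCommGroup E]
    {f : Space d → E} {S : Set (Space d)} (hS : IsCompact S) (hSΩ : S ⊆ Ω)
    (hf : ContinuousOn f Ω) (h0 : ∀ x ∉ S, f x = 0) : IntegrableOn f Ω :=
  ((integrableOn_iff_integrable_of_support_subset fun x hx => not_not.mp fun hxS => hx (h0 x hxS)).mp
    ((hf.mono hSΩ).integrableOn_compact hS)).integrableOn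

theorem integrableOn_smul_of_locallyIntegrableOn {E : Type*} [NormedAddCommGroup E]
    [NormedSpace ℝ E] {f : Space d → E} (hf : LocallyIntegrableOn f Ω) {g : Space d → ℝ}
    (hg : Continuous g) (hgc : HasCompactSupport g) (hgΩ : tsupport g ⊆ Ω) :
    IntegrableOn (fun x => g x • f x) Ω := by
  have h1 : IntegrableOn (fun x => g x • f x) (tsupport g) :=
    (hf.integrableOn_compact_subset hgΩ hgc.isCompact).continuousOn_smul hg.continuousOn
      hgc.isCompact
  refine ((integrableOn_iff_integrable_of_support_subset fun x hx => ?_).mp h1).integrableOn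
  exact not_not.mp fun hx' => hx (by simp [image_eq_zero_of_notMem_tsupport hx'])

/-- A locally integrable field is determined almost everywhere in an open set by its pairings with
smooth compactly supported fields. -/
theorem ae_eq_of_innerOn_eq (hΩ : IsOpen Ω) {w w' : Space d → Space d}
    (hw : LocallyIntegrableOn w Ω) (hw' : LocallyIntegrableOn w' Ω)
    (h : ∀ u, IsCompactlySupportedIn ∞ Ω u → innerOn Ω w u = innerOn Ω w' u) :
    w =ᵐ[volume.restrict Ω] w' := by
  have hcoord : ∀ {f : Space d → Space d}, LocallyIntegrableOn f Ω → ∀ j : Fin d,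
      LocallyIntegrableOn (fun x => f x j) Ω := fun {f} hf j x hx => by
    obtain ⟨t, ht, hft⟩ := hf x hx
    exact ⟨t, ht, (EuclideanSpace.proj j : Space d →L[ℝ] ℝ).integrable_comp hft⟩
  -- Testing with `g` times the `j`-th basis vector isolates the `j`-th coordinate and reduces to
  -- the scalar fundamental lemma.
  have key : ∀ j : Fin d, ∀ᵐ x, x ∈ Ω → w x j - w' x j = 0 := fun j => by
    refine hΩ.ae_eq_zero_of_integral_contDiff_smul_eq_zero
      ((hcoord hw j).sub (hcoord hw' j)) fun g hg hgc hgΩ => ?_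
    have hi := integrableOn_smul_of_locallyIntegrableOn (hcoord hw j) hg.continuous hgc hgΩ
    have hi' := integrableOn_smul_of_locallyIntegrableOn (hcoord hw' j) hg.continuous hgc hgΩ
    rw [← setIntegral_eq_integral_of_forall_compl_eq_zero (s := Ω) fun x hx => by
      rw [image_eq_zero_of_notMem_tsupport fun hx' => hx (hgΩ hx'), zero_smul]]
    have hu : IsCompactlySupportedIn ∞ Ω
        fun x => g x • (EuclideanSpace.single j 1 : Space d) :=
      ⟨hg.smul contDiff_const, hgc.smul_right,
        (tsupport_smul_subset_left g fun _ => (EuclideanSpace.single j 1 : Space d)).trans hgΩ⟩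
    have hpair := h _ hu
    simp only [innerOn, real_inner_smul_right, EuclideanSpace.inner_single_right, one_mul,
      conj_trivial] at hpair
    simp only [smul_sub]
    rw [integral_sub hi hi', sub_eq_zero]
    simpa using hpair
  rw [Filter.EventuallyEq, ae_restrict_iff' hΩ.measurableSet]
  filter_upwards [ae_all_iff.mpr key] with x hx hxΩ
  ext j
  exact sub_eq_zero.mp (hx j hxΩ)

theorem isFormalAdjoint_advection (hΩ : IsOpen Ω) (ha : ContDiffOn ℝ 1 a Ω) (s : ℝ) :
    IsFormalAdjoint Ω (advection s a) fun v => -advection (1 - s) a v := by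
  rintro v ⟨hv, hvc, hvΩ⟩
  have hBc : ContinuousOn (-advection (1 - s) a v) Ω :=
    (continuousOn_advection hΩ ha hv.contDiffOn (1 - s)).neg
  have hfirst : ∀ u, ContDiffOn ℝ 1 u Ω →
      PairingIntegrable Ω v (advection s a u) ∧
        PairingIntegrable Ω (-advection (1 - s) a v) u ∧
        innerOn Ω v (advection s a u) = innerOn Ω (-advection (1 - s) a v) u := by
    intro u hu
    have h1 : PairingIntegrable Ω v (advection s a u) :=
      integrableOn_of_continuousOn_of_eq_zero hvc.isCompact hvΩ
        (hv.continuous.continuousOn.inner (continuousOn_advection hΩ ha hu s)) fun x hx => by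
          rw [image_eq_zero_of_notMem_tsupport hx, inner_zero_left]
    have h2 : PairingIntegrable Ω (-advection (1 - s) a v) u :=
      integrableOn_of_continuousOn_of_eq_zero hvc.isCompact hvΩ
        (hBc.inner hu.continuousOn) fun x hx => by
          rw [Pi.neg_apply, advection_eq_zero_of_notMem_tsupport hx, neg_zero, inner_zero_left]
    refine ⟨h1, h2, ?_⟩
    have hsub : tsupport (fun x => (inner ℝ (v x) (u x) : ℝ) • a x) ⊆ tsupport v :=
      closure_mono fun x hx hx' => hx (by simp [hx'])
    -- The field `(v·u) a` inherits the compact support of `v`, so no boundary term arises, and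
    -- regularity of `a` and `u` inside `Ω` is enough.
    have h3 := setIntegral_divergence_eq_zero hΩ ((hv.contDiffOn.inner ℝ hu).smul ha)
      (hvc.of_isClosed_subset (isClosed_tsupport _) hsub) (hsub.trans hvΩ)
    rw [← sub_eq_zero, innerOn, innerOn, ← integral_sub h1 h2]
    refine (setIntegral_congr_fun hΩ.measurableSet fun x hx => ?_).trans h3
    have hx' := hΩ.mem_nhds hx
    exact inner_advection_sub s ((ha.contDiffAt hx').differentiableAt one_ne_zero)
      ((hu.contDiffAt hx').differentiableAt one_ne_zero)
      (hv.differentiable one_ne_zero x)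
  refine ⟨hfirst, fun w hw hwu => ?_⟩
  refine ae_eq_of_innerOn_eq hΩ hw (hBc.locallyIntegrableOn hΩ.measurableSet) fun u hu => ?_
  rw [← hwu u hu]
  exact (hfirst u (hu.1.contDiffOn.of_le (by norm_cast))).2.2

/-- Formal adjoints only depend on the operators inside `Ω`. -/
theorem IsFormalAdjoint.congr (hΩ : IsOpen Ω) {A A' B B' : (Space d → Space d) → Space d → Space d}
    (h : IsFormalAdjoint Ω A B) (hA : ∀ u, ContDiffOn ℝ 1 u Ω → EqOn (A u) (A' u) Ω)
    (hB : ∀ u, ContDiffOn ℝ 1 u Ω → EqOn (B u) (B' u) Ω) : IsFormalAdjoint Ω A' B' := by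
  intro v hv
  obtain ⟨h1, h2⟩ := h v hv
  have hBv := hB v hv.1.contDiffOn
  have hA1 : ∀ u, ContDiffOn ℝ 1 u Ω → innerOn Ω v (A u) = innerOn Ω v (A' u) := fun u hu =>
    setIntegral_congr_fun hΩ.measurableSet fun x hx => by simp only [hA u hu hx]
  refine ⟨fun u hu => ?_, fun w hw hwu => ?_⟩
  · obtain ⟨h3, h4, h5⟩ := h1 u hu
    refine ⟨h3.congr_fun (fun x hx => by simp only [hA u hu hx]) hΩ.measurableSet,
      h4.congr_fun (fun x hx => by simp only [hBv hx]) hΩ.measurableSet, ?_⟩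
    rw [← hA1 u hu, h5]
    exact setIntegral_congr_fun hΩ.measurableSet fun x hx => by simp only [hBv hx]
  · refine (h2 w hw fun u hu => ?_).trans ?_
    · rw [hA1 u (hu.1.contDiffOn.of_le (by norm_cast)), hwu u hu]
    · filter_upwards [ae_restrict_mem hΩ.measurableSet] with x hx using hBv hx

theorem advection_zero (a u : Space d → Space d) : advection 0 a u = convectiveForm a u := by
  ext1 x
  simp [advection]

theorem eqOn_advection_one (hΩ : IsOpen Ω) (ha : ContDiffOn ℝ 1 a Ω) (hu : ContDiffOn ℝ 1 u Ω) :
    EqOn (advection 1 a u) (divergenceForm a u) Ω := fun x hx =>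
  (divergenceForm_eq_advection ((ha.contDiffAt (hΩ.mem_nhds hx)).differentiableAt one_ne_zero)
    ((hu.contDiffAt (hΩ.mem_nhds hx)).differentiableAt one_ne_zero)).symm

theorem isFormalAdjoint_convectiveForm (hΩ : IsOpen Ω) (ha : ContDiffOn ℝ 1 a Ω) :
    IsFormalAdjoint Ω (convectiveForm a) fun v => -divergenceForm a v :=
  (isFormalAdjoint_advection hΩ ha 0).congr hΩ (fun u _ _ _ => by rw [advection_zero])
    fun u hu x hx => by
      simp only [Pi.neg_apply, sub_zero, eqOn_advection_one hΩ ha hu hx]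

theorem isFormalAdjoint_divergenceForm (hΩ : IsOpen Ω) (ha : ContDiffOn ℝ 1 a Ω) :
    IsFormalAdjoint Ω (divergenceForm a) fun v => -convectiveForm a v :=
  (isFormalAdjoint_advection hΩ ha 1).congr hΩ (fun _ hu => eqOn_advection_one hΩ ha hu)
    fun u _ x _ => by simp only [sub_self, advection_zero]

theorem isFormalAdjoint_skewForm (hΩ : IsOpen Ω) (ha : ContDiffOn ℝ 1 a Ω) :
    IsFormalAdjoint Ω (skewForm a) fun v => -skewForm a v := by
  have h := isFormalAdjoint_advection hΩ ha (1 / 2)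
  rwa [show (1 : ℝ) - 1 / 2 = 1 / 2 by norm_num] at h

end FormalAdjoint

end Advection
end

theorem mainTheorem1 (d : ℕ) (hd : 1 ≤ d) (Ω : Set (Space d)) (hΩ : IsOpen Ω)
    (hbdd : Bornology.IsBounded Ω) (hLip : Advection.HasLipschitzBoundary Ω)
    (a : Space d → Space d) (ha : Advection.IsC1UpToBoundary Ω a) :
    -- the outward unit normal exists almost everywhere on the boundary
    (∀ᵐ x ∂(Advection.surfaceMeasure Ω),
      Advection.IsOutwardUnitNormal Ω x (Advection.outwardNormal Ω x)) ∧
    -- the exact adjoint relation, all integrals being well defined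
    (∀ s : ℝ, ∀ u v : Space d → Space d,
      Advection.IsC1UpToBoundary Ω u → Advection.IsC1UpToBoundary Ω v →
        Advection.PairingIntegrable Ω v (Advection.advection s a u) ∧
        Advection.PairingIntegrable Ω (-Advection.advection (1 - s) a v) u ∧
        Integrable (Advection.boundaryFlux Ω a u v) (Advection.surfaceMeasure Ω) ∧
        Advection.innerOn Ω v (Advection.advection s a u) =
          Advection.innerOn Ω (-Advection.advection (1 - s) a v) u +
            ∫ x, Advection.boundaryFlux Ω a u v x ∂(Advection.surfaceMeasure Ω)) ∧
    -- the adjoint of the advection operator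
    (∀ s : ℝ, Advection.IsFormalAdjoint Ω (Advection.advection s a)
      (fun v => -Advection.advection (1 - s) a v)) ∧
    -- the convective and the divergence form are adjoint to each other, up to sign
    Advection.IsFormalAdjoint Ω (Advection.convectiveForm a)
      (fun v => -Advection.divergenceForm a v) ∧
    Advection.IsFormalAdjoint Ω (Advection.divergenceForm a)
      (fun v => -Advection.convectiveForm a v) ∧
    -- the skew-symmetric form is skew-adjoint
    Advection.IsFormalAdjoint Ω (Advection.skewForm a)
      (fun v => -Advection.skewForm a v) := by
  have ha1 := ha.contDiffOn hΩ
  exact ⟨Advection.ae_isOutwardUnitNormal_outwardNormal hΩ hLip,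
    fun s _ _ hu hv => Advection.advection_adjoint_relation hΩ hbdd hLip ha hu hv s,
    fun s => Advection.isFormalAdjoint_advection hΩ ha1 s,
    Advection.isFormalAdjoint_convectiveForm hΩ ha1,
    Advection.isFormalAdjoint_divergenceForm hΩ ha1,
    Advection.isFormalAdjoint_skewForm hΩ ha1⟩
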